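/- Let $1\le k<d$, let $\sigma>0$ and $0\le\gamma\le 1$. For a matrix $B\in\mathbb R^{d\times k}$ with orthonormal columns and $\alpha\in\mathbb R^k$, let $P_{B,\alpha}$ be the law of $(x,y)$ with $x\sim N(0,I_d)$, $y=x^\top B\alpha+\eta$, where $\eta\sim N(0,\sigma^2)$ is independent of $x$. For $U,V\in\mathbb R^{d\times k}$ with orthonormal columns let $\sin\theta(U,V)=\|UU^\top-VV^\top\|_{\mathrm{op}}$. Fix $\hat B_{\mathrm{pub}}\in\mathbb R^{d\times k}$ with orthonormal columns. Let $M$ be a randomized algorithm that takes a dataset $S$ of $n_2$ examples in $\mathbb R^d\times\mathbb R$ (and knows $\hat B_{\mathrm{pub}}$) and outputs a vector which almost surely lies in the column span of $\hat B_{\mathrm{pub}}$. Assume that $M$ is $(\varepsilon,\delta)$-differentially private: $\Pr[M(S)\in E]\le e^{\varepsilon}\Pr[M(S')\in E]+\delta$ for all measurable $E$ and all $S,S'$ that differ in at most one example. For an instance $(B,\alpha)$ put $$R_M(B,\alpha)=\mathbb E_{S\sim P_{B,\alpha}^{n_2}}\,\mathbb E_M\,\mathbb E_{(x,y)\sim P_{B,\alpha}}\big(y-M(S)^\top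 x\big)^2\in[0,\infty],\qquad r=\frac{k^2}{n_2^2\varepsilon^2}+\frac{k}{n_2}.$$ **Theorem.** For every $C>0$ there is a constant $c>0$, depending only on $C$, such that for every $\omega>0$ there is $n_0$, depending only on $C$ and $\omega$, with the following property. Suppose that $n_2\ge n_0$, $0<\varepsilon<1$, $0\le\delta<n_2^{-(1+\omega)}$ and $k\le C\,n_2\varepsilon$. Then for all $d,k,\sigma,\gamma,\hat B_{\mathrm{pub}}$ and $M$ as above there are $B\in\mathbb R^{d\times k}$ with orthonormal columns and $\alpha_{t+1}\in\mathbb R^k$ such that $\sin\theta(B,\hat B_{\mathrm{pub}})\le\gamma$, $\|B\alpha_{t+1}\|_2\le 1$, $$R_M(B,\alpha_{t+1})\ \ge\ c\,\big(r\,(\sigma^2+\gamma^2)+\gamma^2\big)$$ and, for the excess of the risk over the unavoidable noise $\sigma^2$, $$R_M(B,\alpha_{t+1})\ \ge\ \sigma^2+c\,\big(\min\{1,\;r\,(\sigma^2+\gamma^2)\}+\gamma^2\big).$$ -/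

import Mathlib

open MeasureTheory ProbabilityTheory

noncomputable section

namespace PrivateTransfer

/-- A labelled example `(x, y)` with covariate `x ∈ ℝ^d` and response `y ∈ ℝ`. -/
abbrev Sample (d : ℕ) : Type := EuclideanSpace ℝ (Fin d) × ℝ

/-- A dataset of `n` labelled examples. -/
abbrev Dataset (n d : ℕ) : Type := Fin n → Sample d

/-- `B ∈ ℝ^{d × k}` has orthonormal columns (it represents a point of the Grassmannian of
`k`-dimensional subspaces of `ℝ^d`, namely its column span). -/
def OrthonormalCols {d k : ℕ} (B : Matrix (Fin d) (Fin k) ℝ) : Prop :=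
  B.transpose * B = 1

/-- The vector `B a ∈ ℝ^d`, with the Euclidean norm. -/
def applyMat {d k : ℕ} (B : Matrix (Fin d) (Fin k) ℝ) (a : EuclideanSpace ℝ (Fin k)) :
    EuclideanSpace ℝ (Fin d) :=
  WithLp.toLp 2 (B.mulVec a.ofLp)

/-- Sine of the maximum principal angle between the column spans of two matrices with orthonormal
columns: the `ℓ²` operator norm of the difference `U Uᵀ - V Vᵀ` of the orthogonal projections. -/
def sinTheta {d k : ℕ} (U V : Matrix (Fin d) (Fin k) ℝ) : ℝ :=
  ‖Matrix.toEuclideanCLM (n := Fin d) (𝕜 := ℝ) (U * U.transpose - V * V.transpose)‖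

/-- The law of one example `(x, y)` of the private task `(B, a)`: `x ∼ N(0, I_d)`, `η ∼ N(0, σ²)`
independent of `x`, and `y = xᵀ B a + η`. -/
def taskLaw {d k : ℕ} (B : Matrix (Fin d) (Fin k) ℝ) (a : EuclideanSpace ℝ (Fin k)) (σ : ℝ) :
    Measure (Sample d) :=
  ((stdGaussian (EuclideanSpace ℝ (Fin d))).prod (gaussianReal 0 (σ ^ 2).toNNReal)).map
    (fun p => (p.1, inner ℝ p.1 (applyMat B a) + p.2))

/-- The law of a dataset of `n` i.i.d. examples of the private task `(B, a)`. -/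
def dataLaw {d k : ℕ} (n : ℕ) (B : Matrix (Fin d) (Fin k) ℝ) (a : EuclideanSpace ℝ (Fin k))
    (σ : ℝ) : Measure (Dataset n d) :=
  Measure.pi (fun _ => taskLaw B a σ)

/-- Row-level neighbours: the two datasets differ in at most one example. -/
def Neighboring {n d : ℕ} (S S' : Dataset n d) : Prop :=
  ∃ i, ∀ j, j ≠ i → S j = S' j

/-- `(ε, δ)`-differential privacy of a randomized algorithm, given as a Markov kernel that sends
a dataset to the law of the output. -/
def IsDP {n d : ℕ} (M : Kernel (Dataset n d) (EuclideanSpace ℝ (Fin d))) (ε δ : ℝ) : Prop :=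
  ∀ S S' : Dataset n d, Neighboring S S' → ∀ E : Set (EuclideanSpace ℝ (Fin d)),
    MeasurableSet E → M S E ≤ ENNReal.ofReal (Real.exp ε) * M S' E + ENNReal.ofReal δ

/-- The output of the algorithm lies almost surely in the column span of `Bhat`. -/
def OutputsInColSpan {n d k : ℕ} (M : Kernel (Dataset n d) (EuclideanSpace ℝ (Fin d)))
    (Bhat : Matrix (Fin d) (Fin k) ℝ) : Prop :=
  ∀ S, ∀ᵐ w ∂(M S), ∃ v : EuclideanSpace ℝ (Fin k), w = applyMat Bhat v

/-- The expected squared prediction risk `E_S E_M E_{(x,y)} (y - M(S)ᵀ x)²`, where the fresh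
example `(x, y)` and the dataset come from the task `(B, a)`. It is a Lebesgue integral, with
value `∞` if the expectation diverges. -/
def risk {n d k : ℕ} (M : Kernel (Dataset n d) (EuclideanSpace ℝ (Fin d)))
    (B : Matrix (Fin d) (Fin k) ℝ) (a : EuclideanSpace ℝ (Fin k)) (σ : ℝ) : ENNReal :=
  ∫⁻ S, ∫⁻ w, ∫⁻ z, ENNReal.ofReal ((z.2 - inner ℝ w z.1) ^ 2)
    ∂(taskLaw B a σ) ∂(M S) ∂(dataLaw n B a σ)

/-- The rate `k² / (n² ε²) + k / n` of private linear regression in `k` dimensions. -/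
def privateRate (k n : ℕ) (ε : ℝ) : ℝ :=
  (k : ℝ) ^ 2 / ((n : ℝ) ^ 2 * ε ^ 2) + (k : ℝ) / n

end PrivateTransfer

end

noncomputable section

namespace PrivateTransfer

/-! ### Integrals under approximate privacy; product measures -/

section Generic

open scoped ENNReal

variable {W Z : Type*} [MeasurableSpace W] [MeasurableSpace Z]

/-! The excess of the risk over `σ²` is the mean of `‖Bα - M(S)‖²` (`lintegral_sq_error`), so it
suffices to bound an estimation error from below. Two separate instances do this, and the larger
bound is used.

Subspace error. Rotate one column of `Bhat` by an angle of sine `γ` towards a unit vector `b`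
orthogonal to the span, and let `Bα` be the rotated column. Its component along `b` is `γ`, while
every vector in the span of `Bhat` has component `0`, so the excess is at least `γ²` whatever the
algorithm does (`exists_risk_ge_of_tilt`).

Privacy and sampling error. Keep `B = Bhat`, so that the coordinates of `x` along its columns are
orthonormal features, and let the coefficients `β` range over a box `[-τ, τ]^k`. Suppose that an
estimate `u` has mean squared error at most `R` throughout the box. The field with components `(τ² -
β_j²)(u_j - β_j)` times the likelihood vanishes on the corresponding faces, so its divergence
integrates to zero. Since the log-likelihood has gradient score divided by `σ²`, some `β` must have
correlation of order `σ² k τ²` between `u - β`, weighted, and the total score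
(`le_of_weighted_score_le`). There are two upper bounds on this correlation. By privacy, each
example contributes at most about `ε σ τ² √R`, because a fresh example has mean-zero score
(`integral_coord_le_of_dp`); hence `R` is at least of order `σ² k² / (n² ε²)`. By the second moment
`n σ²` of each total score, `R` is at least of order `σ² k / n`. Both are in
`private_regression_lower_bound`.

Finally `k ≤ C n ε` makes the rate `r` bounded, so the cross term `r γ²` is absorbed into `γ²`. -/

theorem lintegral_le_of_approx_dp {μ ν : Measure W} [IsProbabilityMeasure μ]
    [IsProbabilityMeasure ν] {ε δ T : ℝ}
    (h : ∀ E, MeasurableSet E → μ E ≤ ENNReal.ofReal (Real.exp ε) * ν E + ENNReal.ofReal δ)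
    {g : W → ℝ} (hg : Measurable g) (h0 : ∀ w, 0 ≤ g w) (hT : ∀ w, g w ≤ T) :
    ∫⁻ w, ENNReal.ofReal (g w) ∂μ ≤
      ENNReal.ofReal (Real.exp ε) * ∫⁻ w, ENNReal.ofReal (g w) ∂ν
        + ENNReal.ofReal δ * ENNReal.ofReal T := by
  -- Layer cake: the superlevel sets above `T` are empty, so integrating the additive `δ` over the
  -- levels costs only `δ T`.
  have key : ∀ ρ : Measure W, ∫⁻ w, ENNReal.ofReal (g w) ∂ρ
      = ∫⁻ t in Set.Ioc 0 T, ρ {a | t ≤ g a} := by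
    intro ρ
    rw [lintegral_eq_lintegral_meas_le ρ (Filter.Eventually.of_forall h0) hg.aemeasurable]
    rw [← lintegral_indicator measurableSet_Ioi, ← lintegral_indicator measurableSet_Ioc]
    congr 1
    ext t
    by_cases h1 : 0 < t
    · by_cases h2 : t ≤ T
      · simp [Set.indicator, h1, h2]
      · have : {a | t ≤ g a} = ∅ := by
          ext a
          simpa using (hT a).trans_lt (not_le.1 h2)
        simp [Set.indicator, h1, h2, this]
    · simp [Set.indicator, h1]
  have hanti : ∀ ρ : Measure W, Measurable fun t : ℝ => ρ {a | t ≤ g a} := fun ρ =>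
    Antitone.measurable fun s t hst => measure_mono fun a (ha : t ≤ g a) => hst.trans ha
  rw [key μ, key ν]
  calc ∫⁻ t in Set.Ioc 0 T, μ {a | t ≤ g a}
      ≤ ∫⁻ t in Set.Ioc 0 T,
          (ENNReal.ofReal (Real.exp ε) * ν {a | t ≤ g a} + ENNReal.ofReal δ) :=
        lintegral_mono fun t => h _ (measurableSet_le measurable_const hg)
    _ = _ := by
        rw [lintegral_add_right _ measurable_const, lintegral_const_mul _ (hanti ν)]
        simp

theorem integral_le_of_approx_dp_nonneg {μ ν : Measure W} [IsProbabilityMeasure μ]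
    [IsProbabilityMeasure ν] {ε δ T : ℝ} (hδ : 0 ≤ δ) (hT0 : 0 ≤ T)
    (h : ∀ E, MeasurableSet E → μ E ≤ ENNReal.ofReal (Real.exp ε) * ν E + ENNReal.ofReal δ)
    {g : W → ℝ} (hg : Measurable g) (h0 : ∀ w, 0 ≤ g w) (hT : ∀ w, g w ≤ T) :
    ∫ w, g w ∂μ ≤ Real.exp ε * ∫ w, g w ∂ν + δ * T := by
  have hint : ∀ ρ : Measure W, IsProbabilityMeasure ρ → Integrable g ρ := fun ρ _ =>
    Integrable.of_bound hg.aestronglyMeasurable T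
      (Filter.Eventually.of_forall fun w => by
        rw [Real.norm_of_nonneg (h0 w)]
        exact hT w)
  have h1 := lintegral_le_of_approx_dp h hg h0 hT
  have hν0 : 0 ≤ ∫ w, g w ∂ν := integral_nonneg h0
  rw [← ofReal_integral_eq_lintegral_ofReal (hint μ inferInstance) (Filter.Eventually.of_forall h0),
    ← ofReal_integral_eq_lintegral_ofReal (hint ν inferInstance) (Filter.Eventually.of_forall h0),
    ← ENNReal.ofReal_mul (Real.exp_pos ε).le, ← ENNReal.ofReal_mul hδ,
    ← ENNReal.ofReal_add (by positivity) (by positivity)] at h1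
  exact (ENNReal.ofReal_le_ofReal_iff (by positivity)).1 h1

theorem exp_le_one_add_two_mul {ε : ℝ} (h0 : 0 < ε) (h1 : ε < 1) : Real.exp ε ≤ 1 + 2 * ε := by
  have := (Real.abs_exp_sub_one_le (x := ε) (by rw [abs_of_pos h0]; exact h1.le))
  rw [abs_of_pos h0] at this
  linarith [le_abs_self (Real.exp ε - 1)]

/-- Privacy is used in both directions: from `ν` to `μ` on the positive part of `g`, from `μ` to `ν`
on the negative part. With `exp ε ≤ 1 + 2ε` the two losses add up to `2ε` times the integral of
`|g|`. -/
theorem integral_le_of_approx_dp {μ ν : Measure W} [IsProbabilityMeasure μ]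
    [IsProbabilityMeasure ν] {ε δ T : ℝ} (hε : 0 < ε) (hε1 : ε < 1) (hδ : 0 ≤ δ)
    (h : ∀ E, MeasurableSet E → μ E ≤ ENNReal.ofReal (Real.exp ε) * ν E + ENNReal.ofReal δ)
    (h' : ∀ E, MeasurableSet E → ν E ≤ ENNReal.ofReal (Real.exp ε) * μ E + ENNReal.ofReal δ)
    {g : W → ℝ} (hg : Measurable g) (hT : ∀ w, |g w| ≤ T) :
    ∫ w, g w ∂μ ≤ ∫ w, g w ∂ν + 2 * ε * ∫ w, |g w| ∂ν + 2 * (δ * T) := by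
  have hne : Nonempty W := μ.nonempty_of_neZero
  have hT0 : 0 ≤ T := (abs_nonneg _).trans (hT hne.some)
  have hp : ∀ w, max (g w) 0 ≤ T := fun w => max_le ((le_abs_self _).trans (hT w)) hT0
  have hn : ∀ w, max (-g w) 0 ≤ T := fun w => max_le ((neg_le_abs _).trans (hT w)) hT0
  have hpm : Measurable fun w => max (g w) 0 := hg.max measurable_const
  have hnm : Measurable fun w => max (-g w) 0 := hg.neg.max measurable_const
  have hpi : ∀ ρ : Measure W, IsProbabilityMeasure ρ → Integrable (fun w => max (g w) 0) ρ :=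
    fun ρ _ => Integrable.of_bound hpm.aestronglyMeasurable T
      (Filter.Eventually.of_forall fun w => by
        rw [Real.norm_of_nonneg (le_max_right _ _)]; exact hp w)
  have hni : ∀ ρ : Measure W, IsProbabilityMeasure ρ → Integrable (fun w => max (-g w) 0) ρ :=
    fun ρ _ => Integrable.of_bound hnm.aestronglyMeasurable T
      (Filter.Eventually.of_forall fun w => by
        rw [Real.norm_of_nonneg (le_max_right _ _)]; exact hn w)
  have e1 : ∀ ρ : Measure W, IsProbabilityMeasure ρ →
      ∫ w, g w ∂ρ = ∫ w, max (g w) 0 ∂ρ - ∫ w, max (-g w) 0 ∂ρ := fun ρ _ => by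
    rw [← integral_sub (hpi ρ inferInstance) (hni ρ inferInstance)]
    refine integral_congr_ae (Filter.Eventually.of_forall fun w => ?_)
    rcases le_total (g w) 0 with h | h <;> simp [h]
  have e2 : ∫ w, |g w| ∂ν = ∫ w, max (g w) 0 ∂ν + ∫ w, max (-g w) 0 ∂ν := by
    rw [← integral_add (hpi ν inferInstance) (hni ν inferInstance)]
    refine integral_congr_ae (Filter.Eventually.of_forall fun w => ?_)
    rcases le_total (g w) 0 with h | h <;> simp [h, abs_of_nonneg, abs_of_nonpos]
  have a1 := integral_le_of_approx_dp_nonneg hδ hT0 h hpm (fun w => le_max_right _ _) hp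
  have a2 := integral_le_of_approx_dp_nonneg hδ hT0 h' hnm (fun w => le_max_right _ _) hn
  rw [e1 μ inferInstance, e1 ν inferInstance, e2]
  have p0 : 0 ≤ ∫ w, max (g w) 0 ∂ν := integral_nonneg fun w => le_max_right _ _
  have n0 : 0 ≤ ∫ w, max (-g w) 0 ∂ν := integral_nonneg fun w => le_max_right _ _
  have m0 : 0 ≤ ∫ w, max (-g w) 0 ∂μ := integral_nonneg fun w => le_max_right _ _
  have hδT : 0 ≤ δ * T := mul_nonneg hδ hT0
  have hexp := exp_le_one_add_two_mul hε hε1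
  generalize ∫ w, max (g w) 0 ∂ν = p at *
  generalize ∫ w, max (-g w) 0 ∂ν = q at *
  generalize ∫ w, max (-g w) 0 ∂μ = q' at *
  generalize ∫ w, max (g w) 0 ∂μ = p' at *
  have b1 : Real.exp ε * p ≤ (1 + 2 * ε) * p := mul_le_mul_of_nonneg_right hexp p0
  have b2 : Real.exp ε * q' ≤ (1 + 2 * ε) * q' := mul_le_mul_of_nonneg_right hexp m0
  -- The reverse privacy bound is multiplied by `1 - 2ε`, using `(1 - 2ε)(1 + 2ε) ≤ 1`; when this
  -- factor is not positive the claim is trivial.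
  have b3 : (1 - 2 * ε) * q ≤ q' + δ * T := by
    rcases le_total (1 - 2 * ε) 0 with h3 | h3
    · have := mul_nonpos_of_nonpos_of_nonneg h3 n0
      linarith
    · have : (1 - 2 * ε) * q ≤ (1 - 2 * ε) * ((1 + 2 * ε) * q' + δ * T) :=
        mul_le_mul_of_nonneg_left (a2.trans (by linarith)) h3
      nlinarith [mul_nonneg (sq_nonneg ε) m0, mul_nonneg hε.le hδT]
  linarith

/-- Replacing one coordinate of a product sample by an independent copy preserves its law. -/
theorem measurePreserving_update {n : ℕ} (P : Measure Z) [IsProbabilityMeasure P] (i : Fin n) :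
    MeasurePreserving (fun p : Z × (Fin n → Z) => Function.update p.2 i p.1)
      (P.prod (Measure.pi fun _ : Fin n => P)) (Measure.pi fun _ : Fin n => P) := by
  have hm : Measurable fun p : Z × (Fin n → Z) => Function.update p.2 i p.1 := by
    refine measurable_pi_lambda _ fun j => ?_
    by_cases hj : j = i
    · subst hj
      simpa using measurable_fst
    · simp only [Function.update_of_ne hj]
      exact (measurable_pi_apply j).comp measurable_snd
  refine ⟨hm, (Measure.pi_eq fun s hs => ?_).symm⟩
  rw [Measure.map_apply hm (MeasurableSet.univ_pi hs)]
  have : (fun p : Z × (Fin n → Z) => Function.update p.2 i p.1) ⁻¹' (Set.univ.pi s)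
      = s i ×ˢ (Set.univ.pi (Function.update s i Set.univ)) := by
    ext p
    simp only [Set.mem_preimage, Set.mem_pi, Set.mem_univ, true_implies, Set.mem_prod]
    constructor
    · intro h
      refine ⟨by simpa using h i, fun j => ?_⟩
      by_cases hj : j = i
      · subst hj; simp
      · simpa [hj] using h j
    · rintro ⟨h1, h2⟩ j
      by_cases hj : j = i
      · subst hj; simpa using h1
      · simpa [hj] using h2 j
  rw [this, Measure.prod_prod, Measure.pi_pi,
    ← Finset.mul_prod_erase Finset.univ _ (Finset.mem_univ i),
    ← Finset.mul_prod_erase Finset.univ (fun j => P (s j)) (Finset.mem_univ i)]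
  simp only [Function.update_self, measure_univ, one_mul]
  congr 1
  refine Finset.prod_congr rfl fun j hj => ?_
  rw [Function.update_of_ne (Finset.ne_of_mem_erase hj)]

theorem lintegral_pi_prod_eq_prod (μ : Measure Z) [SigmaFinite μ] :
    ∀ {n : ℕ} (f : Fin n → Z → ℝ≥0∞), (∀ i, Measurable (f i)) →
      ∫⁻ S, ∏ i, f i (S i) ∂(Measure.pi fun _ : Fin n => μ) = ∏ i, ∫⁻ z, f i z ∂μ
  | 0, f, _ => by simp
  | n + 1, f, hf => by
    have e := (measurePreserving_piFinSuccAbove (fun _ : Fin (n + 1) => μ) 0).symm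
    rw [← e.lintegral_comp_emb (MeasurableEquiv.measurableEmbedding _), Fin.prod_univ_succ,
      ← lintegral_pi_prod_eq_prod μ (fun i => f i.succ) fun i => hf _,
      ← lintegral_prod_mul (g := fun S : Fin n → Z => ∏ i : Fin n, f i.succ (S i))
        (hf 0).aemeasurable (Finset.measurable_prod _ fun i _ =>
          (hf _).comp (measurable_pi_apply i)).aemeasurable]
    refine lintegral_congr fun p => ?_
    rw [Fin.prod_univ_succ]
    simp [MeasurableEquiv.piFinSuccAbove]

theorem pi_withDensity {n : ℕ} (μ : Measure Z) [SigmaFinite μ] {f : Z → ℝ≥0∞} (hf : Measurable f)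
    [SigmaFinite (μ.withDensity f)] :
    Measure.pi (fun _ : Fin n => μ.withDensity f)
      = (Measure.pi fun _ : Fin n => μ).withDensity fun S => ∏ i, f (S i) := by
  refine Measure.pi_eq fun s hs => ?_
  rw [withDensity_apply _ (MeasurableSet.univ_pi hs),
    ← lintegral_indicator (MeasurableSet.univ_pi hs)]
  have : ∀ S : Fin n → Z, (Set.univ.pi s).indicator (fun S => ∏ i, f (S i)) S
      = ∏ i, (s i).indicator f (S i) := by
    intro S
    by_cases h : S ∈ Set.univ.pi s
    · rw [Set.indicator_of_mem h]
      exact Finset.prod_congr rfl fun i _ => (Set.indicator_of_mem (h i (Set.mem_univ i)) f).symm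
    · rw [Set.indicator_of_notMem h]
      simp only [Set.mem_pi, Set.mem_univ, true_implies, not_forall] at h
      obtain ⟨i, hi⟩ := h
      exact (Finset.prod_eq_zero (Finset.mem_univ i) (Set.indicator_of_notMem hi f)).symm
  simp_rw [this]
  rw [lintegral_pi_prod_eq_prod μ (fun i => (s i).indicator f) fun i => hf.indicator (hs i)]
  refine Finset.prod_congr rfl fun i _ => ?_
  rw [lintegral_indicator (hs i), withDensity_apply _ (hs i)]

/-- The variance of `|f|` is nonnegative. -/
theorem integral_abs_le_of_integral_sq_le {μ : Measure Z} [IsProbabilityMeasure μ] {f : Z → ℝ}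
    (hf : Integrable f μ) (hf2 : Integrable (fun z => f z ^ 2) μ) {a : ℝ} (ha : 0 ≤ a)
    (h : ∫ z, f z ^ 2 ∂μ ≤ a ^ 2) : ∫ z, |f z| ∂μ ≤ a := by
  have h0 : 0 ≤ ∫ z, (|f z| - ∫ z, |f z| ∂μ) ^ 2 ∂μ := integral_nonneg fun z => sq_nonneg _
  set m := ∫ z, |f z| ∂μ with hm
  have : ∫ z, (|f z| - m) ^ 2 ∂μ = ∫ z, f z ^ 2 ∂μ - m ^ 2 := by
    have e : ∀ z, (|f z| - m) ^ 2 = f z ^ 2 - 2 * m * |f z| + m ^ 2 := fun z => by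
      rw [← sq_abs (f z)]; ring
    simp_rw [e]
    have hi : Integrable (fun z => f z ^ 2 - 2 * m * |f z|) μ := hf2.sub (hf.abs.const_mul _)
    rw [integral_add hi (integrable_const _),
      integral_sub hf2 (hf.abs.const_mul _), integral_const_mul, ← hm]
    simp
    ring
  exact abs_le_of_sq_le_sq' (by linarith) ha |>.2

end Generic

/-! ### Tracing a single example through a private output -/

section Resampling

variable {W Z : Type*} [MeasurableSpace W] [MeasurableSpace Z]

theorem integrable_comp_coord {n : ℕ} {M : Kernel (Fin n → Z) W} [IsMarkovKernel M]
    {P : Measure Z} [IsProbabilityMeasure P] (i : Fin n) {T : Z → ℝ} (hT : Integrable T P) :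
    Integrable (fun p : (Fin n → Z) × W => T (p.1 i)) ((Measure.pi fun _ => P) ⊗ₘ M) := by
  have h1 : Integrable (fun S : Fin n → Z => T (S i)) (Measure.pi fun _ => P) :=
    (measurePreserving_eval (fun _ : Fin n => P) i).integrable_comp_of_integrable hT
  have h2 : MeasurePreserving Prod.fst ((Measure.pi fun _ : Fin n => P) ⊗ₘ M)
      (Measure.pi fun _ => P) := ⟨measurable_fst, Measure.fst_compProd _ _⟩
  exact h2.integrable_comp_of_integrable h1

/-- The tracing bound: a differentially private output is nearly uncorrelated with a statistic of
any single example that has mean zero under a fresh draw of that example. -/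
theorem integral_coord_le_of_dp {n : ℕ} {M : Kernel (Fin n → Z) W} [IsMarkovKernel M] {ε δ : ℝ}
    (hε : 0 < ε) (hε1 : ε < 1) (hδ : 0 ≤ δ)
    (hdp : ∀ S S' : Fin n → Z, (∃ i, ∀ j, j ≠ i → S j = S' j) → ∀ E, MeasurableSet E →
      M S E ≤ ENNReal.ofReal (Real.exp ε) * M S' E + ENNReal.ofReal δ)
    {P : Measure Z} [IsProbabilityMeasure P] (i : Fin n) {A : Z → W → ℝ}
    (hA : Measurable (Function.uncurry A)) {T : Z → ℝ} (hT : Integrable T P)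
    (hAT : ∀ z w, |A z w| ≤ T z) (h0 : ∀ w, ∫ z, A z w ∂P = 0) {b : W → ℝ}
    (hb : ∀ w, ∫ z, |A z w| ∂P ≤ b w)
    (hbi : Integrable (fun p : (Fin n → Z) × W => b p.2) ((Measure.pi fun _ => P) ⊗ₘ M)) :
    ∫ p, A (p.1 i) p.2 ∂((Measure.pi fun _ => P) ⊗ₘ M)
      ≤ 2 * ε * ∫ p, b p.2 ∂((Measure.pi fun _ => P) ⊗ₘ M) + 2 * (δ * ∫ z, T z ∂P) := by
  set D : Measure (Fin n → Z) := Measure.pi fun _ => P with hD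
  have hAm : ∀ z, Measurable (A z) := fun z => hA.comp measurable_prodMk_left
  have hI : Integrable (fun p : (Fin n → Z) × W => A (p.1 i) p.2) (D ⊗ₘ M) := by
    refine (integrable_comp_coord i hT).mono' ?_ (Filter.Eventually.of_forall fun p => hAT _ _)
    have hm : Measurable fun p : (Fin n → Z) × W => (p.1 i, p.2) :=
      ((measurable_pi_apply i).comp measurable_fst).prodMk measurable_snd
    exact (hA.comp hm).aestronglyMeasurable
  have hF : Integrable (fun S => ∫ w, A (S i) w ∂(M S)) D := hI.integral_compProd
  have mp := measurePreserving_update P i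
  rw [Measure.integral_compProd hI]
  -- The `i`-th example is exposed as a separate variable `q.1`, inserted into an independent
  -- dataset `q.2`. Privacy can then compare the output on the modified dataset with the output on
  -- `q.2`, which is independent of `q.1`.
  have e1 : ∫ S, ∫ w, A (S i) w ∂(M S) ∂D
      = ∫ q, ∫ w, A q.1 w ∂(M (Function.update q.2 i q.1)) ∂(P.prod D) := by
    have := integral_map (μ := P.prod D) (f := fun S => ∫ w, A (S i) w ∂(M S))
      mp.measurable.aemeasurable (by rw [mp.map_eq]; exact hF.aestronglyMeasurable)
    rw [mp.map_eq] at this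
    simpa using this
  have hF' : Integrable (fun q : Z × (Fin n → Z) =>
      ∫ w, A q.1 w ∂(M (Function.update q.2 i q.1))) (P.prod D) := by
    have := mp.integrable_comp_of_integrable hF
    simpa [Function.comp_def] using this
  let K : Kernel (Z × (Fin n → Z)) W := M.prodMkLeft Z
  have hTP : Integrable (fun q : Z × (Fin n → Z) => T q.1) (P.prod D) := hT.comp_fst D
  have hJ : Integrable (fun p : (Z × (Fin n → Z)) × W => A p.1.1 p.2) ((P.prod D) ⊗ₘ K) := by
    have h2 : MeasurePreserving Prod.fst ((P.prod D) ⊗ₘ K) (P.prod D) :=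
      ⟨measurable_fst, Measure.fst_compProd _ _⟩
    refine (h2.integrable_comp_of_integrable hTP).mono' ?_
      (Filter.Eventually.of_forall fun p => hAT _ _)
    have hm : Measurable fun p : (Z × (Fin n → Z)) × W => (p.1.1, p.2) :=
      (measurable_fst.comp measurable_fst).prodMk measurable_snd
    exact (hA.comp hm).aestronglyMeasurable
  have hG : Integrable (fun q : Z × (Fin n → Z) => ∫ w, A q.1 w ∂(M q.2)) (P.prod D) :=
    hJ.integral_compProd
  have hGa : Integrable (fun q : Z × (Fin n → Z) => ∫ w, |A q.1 w| ∂(M q.2)) (P.prod D) :=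
    hJ.abs.integral_compProd
  have hPM : ∀ S, Integrable (Function.uncurry A) (P.prod (M S)) := fun S =>
    (hT.comp_fst (M S)).mono' hA.aestronglyMeasurable
      (Filter.Eventually.of_forall fun p => hAT _ _)
  -- After the exchange the example is fresh: integrating over it first, with the output fixed,
  -- gives zero.
  have z1 : ∫ q, ∫ w, A q.1 w ∂(M q.2) ∂(P.prod D) = 0 := by
    rw [integral_prod_symm _ hG]
    refine integral_eq_zero_of_ae (Filter.Eventually.of_forall fun S => ?_)
    show ∫ z, ∫ w, A z w ∂(M S) ∂P = 0
    rw [integral_integral_swap (hPM S)]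
    simp [h0]
  have z2 : ∫ q, ∫ w, |A q.1 w| ∂(M q.2) ∂(P.prod D) ≤ ∫ p, b p.2 ∂(D ⊗ₘ M) := by
    rw [integral_prod_symm _ hGa, Measure.integral_compProd hbi]
    refine integral_mono_ae hGa.integral_prod_right hbi.integral_compProd ?_
    have hbS := (Measure.integrable_compProd_iff hbi.aestronglyMeasurable).1 hbi
    filter_upwards [hbS.1] with S hS
    show ∫ z, ∫ w, |A z w| ∂(M S) ∂P ≤ ∫ w, b w ∂(M S)
    rw [integral_integral_swap (f := fun z w => |A z w|) (hPM S).abs]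
    exact integral_mono (hPM S).abs.integral_prod_right hS hb
  -- For a fixed example the envelope `T q.1` is a constant bound in `w`, as the approximate-privacy
  -- inequality requires.
  have key : ∀ q : Z × (Fin n → Z), ∫ w, A q.1 w ∂(M (Function.update q.2 i q.1))
      ≤ ∫ w, A q.1 w ∂(M q.2) + 2 * ε * ∫ w, |A q.1 w| ∂(M q.2) + 2 * (δ * T q.1) := fun q =>
    integral_le_of_approx_dp hε hε1 hδ
      (hdp _ _ ⟨i, fun j hj => Function.update_of_ne hj _ _⟩)
      (hdp _ _ ⟨i, fun j hj => (Function.update_of_ne hj _ _).symm⟩) (hAm q.1) (hAT q.1)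
  rw [e1]
  have hR := (hG.add (hGa.const_mul (2 * ε))).add ((hTP.const_mul δ).const_mul 2)
  refine (integral_mono hF' hR key).trans ?_
  simp only [Pi.add_apply]
  have hs : Integrable (fun q : Z × (Fin n → Z) =>
      ∫ w, A q.1 w ∂(M q.2) + 2 * ε * ∫ w, |A q.1 w| ∂(M q.2)) (P.prod D) :=
    hG.add (hGa.const_mul (2 * ε))
  rw [integral_add hs ((hTP.const_mul δ).const_mul 2), integral_add hG (hGa.const_mul _), z1,
    integral_const_mul, integral_const_mul, integral_const_mul, integral_fun_fst]
  simp only [zero_add, probReal_univ, one_smul]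
  have : 2 * ε * ∫ q, ∫ w, |A q.1 w| ∂(M q.2) ∂(P.prod D) ≤ 2 * ε * ∫ p, b p.2 ∂(D ⊗ₘ M) :=
    mul_le_mul_of_nonneg_left z2 (by positivity)
  linarith

end Resampling

/-! ### Linear regression with orthonormal features and the moments of its scores -/

section Regression

open scoped NNReal

variable {X : Type*} {k : ℕ}

/-- The residual of an example in the model with coefficients `β`. -/
def residual (ξ : X → Fin k → ℝ) (β : Fin k → ℝ) (z : X × ℝ) : ℝ :=
  z.2 - ∑ j, β j * ξ z.1 j

/-- The `j`-th score of an example in the model with coefficients `β`, up to the noise variance. -/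
def score (ξ : X → Fin k → ℝ) (β : Fin k → ℝ) (j : Fin k) (z : X × ℝ) : ℝ :=
  residual ξ β z * ξ z.1 j

theorem sq_sum_features_eq (ξ : X → Fin k → ℝ) (q : Fin k → ℝ) (x : X) :
    (∑ j, q j * ξ x j) ^ 2 = ∑ j, ∑ l, q j * q l * (ξ x j * ξ x l) := by
  rw [sq, Finset.sum_mul_sum]
  exact Finset.sum_congr rfl fun j _ => Finset.sum_congr rfl fun l _ => by ring

/-- Makes the facts about one score special cases of those about linear combinations. -/
theorem sum_single_score (ξ : X → Fin k → ℝ) (β : Fin k → ℝ) (j : Fin k) (z : X × ℝ) :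
    ∑ l, (Pi.single j 1 : Fin k → ℝ) l * score ξ β l z = score ξ β j z := by
  rw [Finset.sum_eq_single j] <;> simp +contextual

theorem sum_score_eq (ξ : X → Fin k → ℝ) (β q : Fin k → ℝ) (z : X × ℝ) :
    ∑ j, q j * score ξ β j z = (∑ j, q j * ξ z.1 j) * residual ξ β z := by
  rw [Finset.sum_mul]
  exact Finset.sum_congr rfl fun j _ => by rw [score]; ring

variable [MeasurableSpace X]

/-- The law of `(x, ∑ j, β j * ξ x j + η)` for a covariate `x ∼ ν` with feature vector `ξ x` and
independent noise `η ∼ N(0, v)`. -/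
def regressionLaw (ν : Measure X) (ξ : X → Fin k → ℝ) (v : ℝ≥0) (β : Fin k → ℝ) :
    Measure (X × ℝ) :=
  (ν.prod (gaussianReal 0 v)).map fun p => (p.1, ∑ j, β j * ξ p.1 j + p.2)

/-- Features that are measurable, square integrable and orthonormal in `L²(ν)`. -/
structure OrthonormalFeatures (ν : Measure X) (ξ : X → Fin k → ℝ) : Prop where
  measurable : ∀ j, Measurable fun x => ξ x j
  memLp : ∀ j, MemLp (fun x => ξ x j) 2 ν
  integral_mul : ∀ j l, ∫ x, ξ x j * ξ x l ∂ν = if j = l then 1 else 0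

variable {ν : Measure X} {ξ : X → Fin k → ℝ} {v : ℝ≥0}

theorem measurable_sum_features (hξ : ∀ j, Measurable fun x => ξ x j) (β : Fin k → ℝ) :
    Measurable fun p : X × ℝ => ∑ j, β j * ξ p.1 j :=
  Finset.measurable_sum _ fun j _ => ((hξ j).comp measurable_fst).const_mul _

theorem measurable_regression_map (hξ : ∀ j, Measurable fun x => ξ x j) (β : Fin k → ℝ) :
    Measurable fun p : X × ℝ => (p.1, ∑ j, β j * ξ p.1 j + p.2) :=
  measurable_fst.prodMk ((measurable_sum_features hξ β).add measurable_snd)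

theorem isProbabilityMeasure_regressionLaw [IsProbabilityMeasure ν]
    (hξ : ∀ j, Measurable fun x => ξ x j)
    (β : Fin k → ℝ) : IsProbabilityMeasure (regressionLaw ν ξ v β) :=
  Measure.isProbabilityMeasure_map (measurable_regression_map hξ β).aemeasurable

theorem measurable_residual_uncurry (hξ : ∀ j, Measurable fun x => ξ x j) :
    Measurable fun p : (Fin k → ℝ) × (X × ℝ) => residual ξ p.1 p.2 := by
  unfold residual
  refine (measurable_snd.comp measurable_snd).sub (Finset.measurable_sum _ fun j _ => ?_)
  exact ((measurable_pi_apply j).comp measurable_fst).mul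
    ((hξ j).comp (measurable_fst.comp measurable_snd))

theorem measurable_residual (hξ : ∀ j, Measurable fun x => ξ x j) (β : Fin k → ℝ) :
    Measurable (residual ξ β) :=
  (measurable_residual_uncurry hξ).comp measurable_prodMk_left

theorem measurable_score_uncurry (hξ : ∀ j, Measurable fun x => ξ x j) (j : Fin k) :
    Measurable fun p : (Fin k → ℝ) × (X × ℝ) => score ξ p.1 j p.2 :=
  (measurable_residual_uncurry hξ).mul ((hξ j).comp (measurable_fst.comp measurable_snd))

theorem measurable_score (hξ : ∀ j, Measurable fun x => ξ x j) (β : Fin k → ℝ) (j : Fin k) :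
    Measurable (score ξ β j) :=
  (measurable_score_uncurry hξ j).comp measurable_prodMk_left

/-- Subtracting the regression function inverts the map defining the model. The residual is thus
Gaussian noise independent of the covariate, and moments of scores factor into a feature moment and
a noise moment. -/
theorem measurePreserving_residual (hξ : ∀ j, Measurable fun x => ξ x j) (β : Fin k → ℝ) :
    MeasurePreserving (fun z : X × ℝ => (z.1, residual ξ β z)) (regressionLaw ν ξ v β)
      (ν.prod (gaussianReal 0 v)) := by
  have hm : Measurable fun z : X × ℝ => (z.1, residual ξ β z) :=
    measurable_fst.prodMk (measurable_residual hξ β)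
  refine ⟨hm, ?_⟩
  rw [regressionLaw, Measure.map_map hm (measurable_regression_map hξ β)]
  convert Measure.map_id
  ext p <;> simp [residual]

theorem integral_residual_comp (hξ : ∀ j, Measurable fun x => ξ x j) (β : Fin k → ℝ)
    {F : X × ℝ → ℝ} (hF : Measurable F) :
    ∫ z, F (z.1, residual ξ β z) ∂(regressionLaw ν ξ v β)
      = ∫ p, F p ∂(ν.prod (gaussianReal 0 v)) := by
  have h := measurePreserving_residual (ν := ν) (v := v) hξ β
  rw [← h.map_eq, integral_map h.measurable.aemeasurable hF.aestronglyMeasurable]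

theorem integrable_sq_gaussianReal : Integrable (fun y : ℝ => y ^ 2) (gaussianReal 0 v) :=
  (memLp_two_iff_integrable_sq measurable_id.aestronglyMeasurable).1
    (memLp_id_gaussianReal (μ := 0) (v := v) 2)

theorem integral_sq_gaussianReal : ∫ y, y ^ 2 ∂(gaussianReal 0 v) = v := by
  have := variance_id_gaussianReal (μ := 0) (v := v)
  rw [variance_of_integral_eq_zero measurable_id.aemeasurable
    (by simp [integral_id_gaussianReal])] at this
  simpa using this

namespace OrthonormalFeatures

variable (h : OrthonormalFeatures ν ξ)
include h

theorem integrable_mul (j l : Fin k) : Integrable (fun x => ξ x j * ξ x l) ν :=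
  (h.memLp j).integrable_mul (h.memLp l)

theorem integrable_sq_sum (q : Fin k → ℝ) : Integrable (fun x => (∑ j, q j * ξ x j) ^ 2) ν := by
  simp_rw [sq_sum_features_eq ξ q]
  exact integrable_finsetSum _ fun j _ => integrable_finsetSum _ fun l _ =>
    (h.integrable_mul j l).const_mul _

theorem integral_sq_sum (q : Fin k → ℝ) :
    ∫ x, (∑ j, q j * ξ x j) ^ 2 ∂ν = ∑ j, q j ^ 2 := by
  simp_rw [sq_sum_features_eq ξ q]
  rw [integral_finsetSum _ fun j _ => integrable_finsetSum _ fun l _ =>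
    (h.integrable_mul j l).const_mul _]
  refine Finset.sum_congr rfl fun j _ => ?_
  rw [integral_finsetSum _ fun l _ => (h.integrable_mul j l).const_mul _]
  simp_rw [integral_const_mul, h.integral_mul]
  simp [sq]

theorem integrable_sum_score_sq (β q : Fin k → ℝ) :
    Integrable (fun z => (∑ j, q j * score ξ β j z) ^ 2) (regressionLaw ν ξ v β) := by
  have := (measurePreserving_residual (ν := ν) (v := v) h.measurable β).integrable_comp_of_integrable
    ((h.integrable_sq_sum q).mul_prod (integrable_sq_gaussianReal (v := v)))
  refine this.congr (Filter.Eventually.of_forall fun z => ?_)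
  simp only [Function.comp, sum_score_eq, mul_pow]

theorem measurable_sum_score (β q : Fin k → ℝ) :
    Measurable fun z => ∑ j, q j * score ξ β j z :=
  Finset.measurable_sum _ fun j _ => (measurable_score h.measurable β j).const_mul _

theorem memLp_sum_score (β q : Fin k → ℝ) :
    MemLp (fun z => ∑ j, q j * score ξ β j z) 2 (regressionLaw ν ξ v β) :=
  (memLp_two_iff_integrable_sq (h.measurable_sum_score β q).aestronglyMeasurable).2
    (h.integrable_sum_score_sq β q)

theorem memLp_score (β : Fin k → ℝ) (j : Fin k) :
    MemLp (score ξ β j) 2 (regressionLaw ν ξ v β) := by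
  simpa only [sum_single_score] using h.memLp_sum_score (v := v) β (Pi.single j 1)

theorem measurable_totalScore {n : ℕ} (β : Fin k → ℝ) (j : Fin k) :
    Measurable fun S : Fin n → X × ℝ => ∑ i, score ξ β j (S i) :=
  Finset.measurable_sum _ fun i _ =>
    (measurable_score h.measurable β j).comp (measurable_pi_apply i)

variable [IsProbabilityMeasure ν]

theorem integral_sum_score_sq (β q : Fin k → ℝ) :
    ∫ z, (∑ j, q j * score ξ β j z) ^ 2 ∂(regressionLaw ν ξ v β) = v * ∑ j, q j ^ 2 := by
  have hm : Measurable fun p : X × ℝ => (∑ j, q j * ξ p.1 j) ^ 2 * p.2 ^ 2 :=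
    ((measurable_sum_features h.measurable q).pow_const 2).mul (measurable_snd.pow_const 2)
  have e := integral_residual_comp (ν := ν) (v := v) h.measurable β hm
  rw [integral_prod_mul (fun x => (∑ j, q j * ξ x j) ^ 2) (fun y : ℝ => y ^ 2),
    h.integral_sq_sum, integral_sq_gaussianReal, mul_comm] at e
  rw [← e]
  refine integral_congr_ae (Filter.Eventually.of_forall fun z => ?_)
  simp only [sum_score_eq, mul_pow]

theorem integrable_sum_score (β q : Fin k → ℝ) :
    Integrable (fun z => ∑ j, q j * score ξ β j z) (regressionLaw ν ξ v β) :=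
  have := isProbabilityMeasure_regressionLaw (ν := ν) (v := v) h.measurable β
  (h.memLp_sum_score β q).integrable one_le_two

theorem integral_sum_score (β q : Fin k → ℝ) :
    ∫ z, ∑ j, q j * score ξ β j z ∂(regressionLaw ν ξ v β) = 0 := by
  have hm : Measurable fun p : X × ℝ => (∑ j, q j * ξ p.1 j) * p.2 :=
    (measurable_sum_features h.measurable q).mul measurable_snd
  have e := integral_residual_comp (ν := ν) (v := v) h.measurable β hm
  rw [integral_prod_mul (fun x => ∑ j, q j * ξ x j) (fun y : ℝ => y),
    integral_id_gaussianReal, mul_zero] at e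
  rw [← e]
  refine integral_congr_ae (Filter.Eventually.of_forall fun z => ?_)
  simp only [sum_score_eq]

theorem integral_abs_sum_score_le {σ : ℝ} (hσ : 0 ≤ σ) (hv : (v : ℝ) = σ ^ 2) (β q : Fin k → ℝ) :
    ∫ z, |∑ j, q j * score ξ β j z| ∂(regressionLaw ν ξ v β) ≤ σ * √(∑ j, q j ^ 2) := by
  have := isProbabilityMeasure_regressionLaw (ν := ν) (v := v) h.measurable β
  refine integral_abs_le_of_integral_sq_le (h.integrable_sum_score β q)
    (h.integrable_sum_score_sq β q) (by positivity) ?_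
  rw [h.integral_sum_score_sq, mul_pow, Real.sq_sqrt (Finset.sum_nonneg fun j _ => sq_nonneg _), hv]

theorem integrable_score (β : Fin k → ℝ) (j : Fin k) :
    Integrable (score ξ β j) (regressionLaw ν ξ v β) := by
  simpa only [sum_single_score] using h.integrable_sum_score (v := v) β (Pi.single j 1)

theorem integral_score (β : Fin k → ℝ) (j : Fin k) :
    ∫ z, score ξ β j z ∂(regressionLaw ν ξ v β) = 0 := by
  simpa only [sum_single_score] using h.integral_sum_score (v := v) β (Pi.single j 1)

theorem integral_score_sq (β : Fin k → ℝ) (j : Fin k) :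
    ∫ z, score ξ β j z ^ 2 ∂(regressionLaw ν ξ v β) = v := by
  have := h.integral_sum_score_sq (v := v) β (Pi.single j 1)
  simp only [sum_single_score] at this
  rw [this, Finset.sum_eq_single j] <;> simp +contextual

theorem integral_abs_score_le {σ : ℝ} (hσ : 0 ≤ σ) (hv : (v : ℝ) = σ ^ 2) (β : Fin k → ℝ)
    (j : Fin k) : ∫ z, |score ξ β j z| ∂(regressionLaw ν ξ v β) ≤ σ := by
  have := isProbabilityMeasure_regressionLaw (ν := ν) (v := v) h.measurable β
  refine integral_abs_le_of_integral_sq_le (h.integrable_score β j) (h.memLp_score β j).integrable_sq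
    hσ ?_
  rw [h.integral_score_sq, hv]

theorem memLp_totalScore {n : ℕ} (β : Fin k → ℝ) (j : Fin k) :
    MemLp (fun S : Fin n → X × ℝ => ∑ i, score ξ β j (S i)) 2
      (Measure.pi fun _ => regressionLaw ν ξ v β) := by
  have := isProbabilityMeasure_regressionLaw (ν := ν) (v := v) h.measurable β
  exact memLp_finsetSum _ fun i _ => (h.memLp_score β j).comp_measurePreserving
    (measurePreserving_eval (fun _ : Fin n => regressionLaw ν ξ v β) i)

/-- The scores of distinct examples are independent and centred, so the cross terms vanish and the
variances add. -/
theorem integral_totalScore_sq {n : ℕ} (β : Fin k → ℝ) (j : Fin k) :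
    ∫ S : Fin n → X × ℝ, (∑ i, score ξ β j (S i)) ^ 2 ∂(Measure.pi fun _ => regressionLaw ν ξ v β)
      = n * v := by
  have := isProbabilityMeasure_regressionLaw (ν := ν) (v := v) h.measurable β
  set P := regressionLaw ν ξ v β with hP
  have mp := fun i => measurePreserving_eval (fun _ : Fin n => P) i
  have hi : ∀ i : Fin n, ∫ S : Fin n → X × ℝ, score ξ β j (S i) ∂(Measure.pi fun _ => P) = 0 := by
    intro i
    have := integral_map (μ := Measure.pi fun _ : Fin n => P) (f := score ξ β j)
      (mp i).measurable.aemeasurable (measurable_score h.measurable β j).aestronglyMeasurable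
    rw [(mp i).map_eq, hP, h.integral_score] at this
    exact this.symm
  have hi2 : ∀ i : Fin n,
      ∫ S : Fin n → X × ℝ, score ξ β j (S i) ^ 2 ∂(Measure.pi fun _ => P) = v := by
    intro i
    have := integral_map (μ := Measure.pi fun _ : Fin n => P) (f := fun z => score ξ β j z ^ 2)
      (mp i).measurable.aemeasurable
      ((measurable_score h.measurable β j).pow_const 2).aestronglyMeasurable
    rw [(mp i).map_eq, hP, h.integral_score_sq] at this
    exact this.symm
  have hmem : ∀ i : Fin n, MemLp (fun S : Fin n → X × ℝ => score ξ β j (S i)) 2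
      (Measure.pi fun _ => P) := fun i => (h.memLp_score β j).comp_measurePreserving (mp i)
  have hmeas : ∀ i : Fin n, Measurable (fun S : Fin n → X × ℝ => score ξ β j (S i)) :=
    fun i => (measurable_score h.measurable β j).comp (measurable_pi_apply i)
  have hv := IndepFun.variance_sum (μ := Measure.pi fun _ : Fin n => P)
    (X := fun (i : Fin n) (S : Fin n → X × ℝ) => score ξ β j (S i)) (s := Finset.univ)
    (fun i _ => hmem i) (fun i _ l _ hil =>
      (iIndepFun_pi (μ := fun _ : Fin n => P) (X := fun _ => score ξ β j)
        fun _ => (measurable_score h.measurable β j).aemeasurable).indepFun hil)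
  rw [variance_of_integral_eq_zero] at hv
  · simp only [Finset.sum_apply] at hv
    rw [hv, Finset.sum_congr rfl fun i _ => ?_]
    · rw [Finset.sum_const, Finset.card_univ, Fintype.card_fin, nsmul_eq_mul]
    · rw [variance_of_integral_eq_zero (hmeas i).aemeasurable (hi i), hi2]
  · exact (Finset.aemeasurable_sum _ fun i _ => (hmeas i).aemeasurable)
  · simp only [Finset.sum_apply]
    rw [integral_finsetSum _ fun i _ => (hmem i).integrable one_le_two]
    simp [hi]

end OrthonormalFeatures

end Regression

/-! ### The divergence theorem on a box -/

section BoxDivergence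

/-- A vector field whose `j`-th component vanishes on the faces `β j = ±τ` of the box `[-τ, τ]^k`
has total divergence zero. -/
theorem integral_box_divergence_eq_zero {k : ℕ} (hk : 1 ≤ k) {τ : ℝ} (hτ : 0 ≤ τ)
    {G : Fin k → (Fin k → ℝ) → ℝ} {G' : Fin k → (Fin k → ℝ) → (Fin k → ℝ) →L[ℝ] ℝ}
    (hG : ∀ j β, HasFDerivAt (G j) (G' j β) β)
    (h0 : ∀ j β, β j = τ ∨ β j = -τ → G j β = 0)
    (hc : Continuous fun β => ∑ j, G' j β (Pi.single j 1)) :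
    ∫ β in Set.Icc (fun _ => -τ) (fun _ => τ), ∑ j, G' j β (Pi.single j 1) = 0 := by
  -- The divergence theorem needs a positive dimension: faces are indexed by `Fin m` inside `Fin (m
  -- + 1)`.
  obtain ⟨m, rfl⟩ : ∃ m, k = m + 1 := ⟨k - 1, by omega⟩
  rw [integral_divergence_of_hasFDerivAt_off_countable' (fun _ => -τ) (fun _ => τ)
    (fun _ => by simp only; linarith) G G' ∅ Set.countable_empty
    (fun i => fun β _ => (hG i β).continuousAt.continuousWithinAt) (fun β _ i => hG i β)
    (hc.continuousOn.integrableOn_compact isCompact_Icc)]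
  refine Finset.sum_eq_zero fun i _ => ?_
  have h1 : ∀ x : Fin m → ℝ, G i (i.insertNth τ x) = 0 := fun x => h0 _ _ (Or.inl (by simp))
  have h2 : ∀ x : Fin m → ℝ, G i (i.insertNth (-τ) x) = 0 := fun x => h0 _ _ (Or.inr (by simp))
  simp [h1, h2]

theorem volume_real_box_pos {k : ℕ} {τ : ℝ} (hτ : 0 < τ) :
    0 < (volume : Measure (Fin k → ℝ)).real (Set.Icc (fun _ => -τ) (fun _ => τ)) := by
  rw [Measure.real, Real.volume_Icc_pi_toReal (fun _ => by simp only; linarith)]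
  exact Finset.prod_pos fun _ _ => by linarith

/-- The field `(τ² - β_j²) β_j` vanishes on the faces and has divergence `∑ (τ² - 3 β_j²)`. So
`β_j²`, summed over `j`, averages to `k τ² / 3`, and no iterated integral is needed. -/
theorem integral_box_weight {k : ℕ} (hk : 1 ≤ k) {τ : ℝ} (hτ : 0 ≤ τ) :
    ∫ β : Fin k → ℝ in Set.Icc (fun _ => -τ) (fun _ => τ), ∑ j, (τ ^ 2 - β j ^ 2)
      = (volume : Measure (Fin k → ℝ)).real (Set.Icc (fun _ => -τ) (fun _ => τ))
        * (2 * k * τ ^ 2 / 3) := by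
  have hp : ∀ t : ℝ, HasDerivAt (fun t => (τ ^ 2 - t ^ 2) * t) (τ ^ 2 - 3 * t ^ 2) t := fun t => by
    refine (((hasDerivAt_pow 2 t).const_sub (τ ^ 2)).mul (hasDerivAt_id t)).congr_deriv ?_
    simp only [id, Nat.cast_ofNat]
    ring
  have hz := integral_box_divergence_eq_zero hk hτ (G := fun j β => (τ ^ 2 - β j ^ 2) * β j)
    (G' := fun j β => (τ ^ 2 - 3 * β j ^ 2) • ContinuousLinearMap.proj (R := ℝ) j)
    (fun j β => (hp (β j)).comp_hasFDerivAt β (ContinuousLinearMap.proj (R := ℝ) j).hasFDerivAt)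
    (fun j β h => by rcases h with h | h <;> simp [h])
    (by
      simp only [_root_.smul_apply, ContinuousLinearMap.proj_apply, Pi.single_eq_same]
      fun_prop)
  simp only [_root_.smul_apply, ContinuousLinearMap.proj_apply, Pi.single_eq_same,
    smul_eq_mul, mul_one] at hz
  have hi : ∀ g : (Fin k → ℝ) → ℝ, Continuous g →
      Integrable g (volume.restrict (Set.Icc (fun _ => -τ) (fun _ => τ))) :=
    fun g hg => hg.continuousOn.integrableOn_compact isCompact_Icc
  have e : ∀ β : Fin k → ℝ, ∑ j, (τ ^ 2 - β j ^ 2)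
      = 2 * k * τ ^ 2 / 3 + (1 / 3) * ∑ j, (τ ^ 2 - 3 * β j ^ 2) := fun β => by
    simp only [Finset.sum_sub_distrib, Finset.sum_const, Finset.card_univ, Fintype.card_fin,
      nsmul_eq_mul, ← Finset.mul_sum]
    ring
  simp_rw [e]
  rw [integral_add (hi _ continuous_const) (hi _ (by fun_prop)), integral_const_mul, hz]
  simp [Measure.real]

end BoxDivergence

/-! ### The Gaussian likelihood and its gradient in the coefficients -/

section Likelihood

open scoped NNReal

variable {X : Type*} {k : ℕ}

/-- The density of `n` examples of the model with coefficients `β`, relative to the covariate law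
times the Lebesgue measure of the responses. -/
def likelihood (ξ : X → Fin k → ℝ) (v : ℝ≥0) {n : ℕ} (β : Fin k → ℝ) (S : Fin n → X × ℝ) : ℝ :=
  ∏ i, gaussianPDFReal (∑ j, β j * ξ (S i).1 j) v (S i).2

theorem likelihood_nonneg (ξ : X → Fin k → ℝ) (v : ℝ≥0) {n : ℕ} (β : Fin k → ℝ)
    (S : Fin n → X × ℝ) : 0 ≤ likelihood ξ v β S :=
  Finset.prod_nonneg fun _ _ => gaussianPDFReal_nonneg _ _ _

theorem likelihood_eq (ξ : X → Fin k → ℝ) (v : ℝ≥0) {n : ℕ} (β : Fin k → ℝ) (S : Fin n → X × ℝ) :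
    likelihood ξ v β S = (√(2 * Real.pi * v))⁻¹ ^ n
      * Real.exp (-∑ i, residual ξ β (S i) ^ 2 / (2 * v)) := by
  simp only [likelihood, gaussianPDFReal, Finset.prod_mul_distrib, ← Real.exp_sum, residual]
  simp [neg_div]

theorem hasFDerivAt_residual (ξ : X → Fin k → ℝ) (β : Fin k → ℝ) (z : X × ℝ) :
    HasFDerivAt (fun β => residual ξ β z)
      (-∑ j, ξ z.1 j • ContinuousLinearMap.proj (R := ℝ) (φ := fun _ : Fin k => ℝ) j) β := by
  refine (HasFDerivAt.fun_sum fun j _ => ?_).const_sub _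
  exact (ContinuousLinearMap.proj (R := ℝ) (φ := fun _ : Fin k => ℝ) j).hasFDerivAt.mul_const _

/-- The exponent is a sum of squared residuals, each affine in `β`; differentiating it produces the
total scores divided by the variance. -/
theorem hasFDerivAt_likelihood (ξ : X → Fin k → ℝ) (v : ℝ≥0) {n : ℕ} (β : Fin k → ℝ)
    (S : Fin n → X × ℝ) :
    HasFDerivAt (fun β => likelihood ξ v β S)
      (likelihood ξ v β S • ∑ j, ((∑ i, score ξ β j (S i)) / v) •
        ContinuousLinearMap.proj (R := ℝ) (φ := fun _ : Fin k => ℝ) j) β := by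
  have h1 : HasFDerivAt (fun β => -∑ i, residual ξ β (S i) ^ 2 / (2 * v))
      (∑ j, ((∑ i, score ξ β j (S i)) / v) •
        ContinuousLinearMap.proj (R := ℝ) (φ := fun _ : Fin k => ℝ) j) β := by
    have := (HasFDerivAt.fun_sum (u := Finset.univ) fun (i : Fin n) _ =>
      ((hasFDerivAt_residual ξ β (S i)).pow 2).mul_const ((2 * v : ℝ)⁻¹)).neg
    refine (this.congr_fderiv ?_)
    ext t
    simp only [_root_.neg_apply, _root_.sum_apply,
      _root_.smul_apply, ContinuousLinearMap.proj_apply, smul_eq_mul, score,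
      Finset.sum_div, Finset.sum_mul]
    rw [Finset.sum_comm, ← Finset.sum_neg_distrib]
    refine Finset.sum_congr rfl fun i _ => ?_
    simp only [mul_neg, Finset.mul_sum, ← Finset.sum_neg_distrib]
    refine Finset.sum_congr rfl fun j _ => ?_
    -- For `v = 0` both sides vanish, because division by zero gives zero.
    by_cases hv : (v : ℝ) = 0
    · simp [hv]
    · field_simp
      simp only [Nat.add_one_sub_one, pow_one, nsmul_eq_mul, Nat.cast_ofNat]
      ring
  simp_rw [likelihood_eq]
  refine (h1.exp.const_mul _).congr_fderiv ?_
  rw [smul_smul]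

theorem continuous_score (ξ : X → Fin k → ℝ) (j : Fin k) (z : X × ℝ) :
    Continuous fun β => score ξ β j z := by
  unfold score residual
  fun_prop

variable [MeasurableSpace X] {ν : Measure X} {ξ : X → Fin k → ℝ} {v : ℝ≥0}

theorem measurable_likelihood (hξ : ∀ j, Measurable fun x => ξ x j) {n : ℕ} :
    Measurable fun p : (Fin n → X × ℝ) × (Fin k → ℝ) => likelihood ξ v p.2 p.1 := by
  simp only [likelihood_eq]
  have := fun i => (measurable_residual_uncurry hξ).comp
    ((measurable_snd (α := Fin n → X × ℝ) (β := Fin k → ℝ)).prodMk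
      ((measurable_pi_apply i).comp measurable_fst))
  exact (Real.measurable_exp.comp (Finset.measurable_sum _ fun i _ =>
    ((this i).pow_const 2).div_const _).neg).const_mul _

/-- Given `x`, the response is a translated Gaussian. The reference measure does not depend on `β`,
which later permits exchanging the integrals over the sample and over `β`. -/
theorem regressionLaw_eq_withDensity [IsProbabilityMeasure ν]
    (hξ : ∀ j, Measurable fun x => ξ x j) (hv : v ≠ 0) (β : Fin k → ℝ) :
    regressionLaw ν ξ v β = (ν.prod volume).withDensity
      fun z => gaussianPDF (∑ j, β j * ξ z.1 j) v z.2 := by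
  have hd : Measurable fun z : X × ℝ => gaussianPDF (∑ j, β j * ξ z.1 j) v z.2 :=
    measurable_uncurry_gaussianPDF.comp ((measurable_sum_features hξ β).prodMk
      (measurable_const.prodMk measurable_snd))
  have hmap := measurable_regression_map hξ β
  ext s hs
  rw [regressionLaw, Measure.map_apply hmap hs, Measure.prod_apply (hmap hs),
    withDensity_apply _ hs, ← lintegral_indicator hs,
    lintegral_prod _ (hd.indicator hs).aemeasurable]
  refine lintegral_congr fun x => ?_
  have hsx : MeasurableSet (Prod.mk x ⁻¹' s) := measurable_prodMk_left hs
  have := gaussianReal_map_const_add (μ := 0) (v := v) (∑ j, β j * ξ x j)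
  rw [zero_add] at this
  calc gaussianReal 0 v (Prod.mk x ⁻¹' ((fun p : X × ℝ => (p.1, ∑ j, β j * ξ p.1 j + p.2)) ⁻¹' s))
      = (gaussianReal 0 v).map (fun y => ∑ j, β j * ξ x j + y) (Prod.mk x ⁻¹' s) := by
        rw [Measure.map_apply (measurable_const_add _) hsx]
        rfl
    _ = ∫⁻ y in Prod.mk x ⁻¹' s, gaussianPDF (∑ j, β j * ξ x j) v y := by
        rw [this, gaussianReal_apply _ hv]
    _ = _ := by
        rw [← lintegral_indicator hsx]
        rfl

theorem pi_regressionLaw_eq_withDensity [IsProbabilityMeasure ν]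
    (hξ : ∀ j, Measurable fun x => ξ x j) (hv : v ≠ 0) (n : ℕ) (β : Fin k → ℝ) :
    Measure.pi (fun _ : Fin n => regressionLaw ν ξ v β)
      = (Measure.pi fun _ : Fin n => ν.prod volume).withDensity
        fun S => ENNReal.ofReal (likelihood ξ v β S) := by
  have hd : Measurable fun z : X × ℝ => gaussianPDF (∑ j, β j * ξ z.1 j) v z.2 :=
    measurable_uncurry_gaussianPDF.comp ((measurable_sum_features hξ β).prodMk
      (measurable_const.prodMk measurable_snd))
  have hp := isProbabilityMeasure_regressionLaw (ν := ν) (v := v) hξ β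
  rw [regressionLaw_eq_withDensity hξ hv] at hp ⊢
  rw [pi_withDensity _ hd]
  congr 1
  ext S
  rw [likelihood, ENNReal.ofReal_prod_of_nonneg fun _ _ => gaussianPDFReal_nonneg _ _ _]
  rfl

end Likelihood

/-! ### Correlation with the score, averaged over the box -/

section Bayes

open scoped NNReal

variable {X : Type*} [MeasurableSpace X] {k : ℕ} {ν : Measure X} [IsProbabilityMeasure ν]
  {ξ : X → Fin k → ℝ} {v : ℝ≥0}

theorem measurable_likelihood_const (hξ : ∀ j, Measurable fun x => ξ x j) {n : ℕ}
    (β : Fin k → ℝ) : Measurable fun S : Fin n → X × ℝ => likelihood ξ v β S := by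
  simp only [likelihood_eq]
  exact (Real.measurable_exp.comp (Finset.measurable_sum _ fun i _ =>
    (((measurable_residual hξ β).comp (measurable_pi_apply i)).pow_const 2).div_const _).neg).const_mul _

theorem integrable_pi_regressionLaw_iff (hξ : ∀ j, Measurable fun x => ξ x j) (hv : v ≠ 0) {n : ℕ}
    (β : Fin k → ℝ) {F : (Fin n → X × ℝ) → ℝ} :
    Integrable F (Measure.pi fun _ => regressionLaw ν ξ v β) ↔
      Integrable (fun S => likelihood ξ v β S * F S)
        (Measure.pi fun _ : Fin n => ν.prod volume) := by
  have hm := measurable_likelihood_const (v := v) (n := n) hξ β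
  rw [pi_regressionLaw_eq_withDensity hξ hv,
    integrable_withDensity_iff_integrable_smul' hm.ennreal_ofReal
      (Filter.Eventually.of_forall fun _ => ENNReal.ofReal_lt_top)]
  simp only [ENNReal.toReal_ofReal (likelihood_nonneg _ _ _ _), smul_eq_mul]

theorem integral_pi_regressionLaw (hξ : ∀ j, Measurable fun x => ξ x j) (hv : v ≠ 0) {n : ℕ}
    (β : Fin k → ℝ) (F : (Fin n → X × ℝ) → ℝ) :
    ∫ S, F S ∂(Measure.pi fun _ => regressionLaw ν ξ v β)
      = ∫ S, likelihood ξ v β S * F S ∂(Measure.pi fun _ : Fin n => ν.prod volume) := by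
  have hm := measurable_likelihood_const (v := v) (n := n) hξ β
  rw [pi_regressionLaw_eq_withDensity hξ hv,
    integral_withDensity_eq_integral_toReal_smul hm.ennreal_ofReal
      (Filter.Eventually.of_forall fun _ => ENNReal.ofReal_lt_top)]
  simp only [ENNReal.toReal_ofReal (likelihood_nonneg _ _ _ _), smul_eq_mul]

theorem mem_box_iff {τ : ℝ} {β : Fin k → ℝ} :
    β ∈ Set.Icc (fun _ => -τ) (fun _ => τ) ↔ ∀ j, |β j| ≤ τ := by
  simp only [Set.mem_Icc, Pi.le_def, abs_le, forall_and]

namespace OrthonormalFeatures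

variable (h : OrthonormalFeatures ν ξ)
include h

theorem integrable_totalScore {n : ℕ} (β : Fin k → ℝ) (j : Fin k) :
    Integrable (fun S : Fin n → X × ℝ => ∑ i, score ξ β j (S i))
      (Measure.pi fun _ => regressionLaw ν ξ v β) :=
  have := isProbabilityMeasure_regressionLaw (ν := ν) (v := v) h.measurable β
  (h.memLp_totalScore β j).integrable one_le_two

theorem integral_abs_totalScore_le {n : ℕ} (β : Fin k → ℝ) (j : Fin k) :
    ∫ S : Fin n → X × ℝ, |∑ i, score ξ β j (S i)| ∂(Measure.pi fun _ => regressionLaw ν ξ v β)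
      ≤ √(n * v) := by
  have := isProbabilityMeasure_regressionLaw (ν := ν) (v := v) h.measurable β
  refine integral_abs_le_of_integral_sq_le (h.integrable_totalScore β j)
    (h.memLp_totalScore β j).integrable_sq (Real.sqrt_nonneg _) ?_
  rw [h.integral_totalScore_sq, Real.sq_sqrt (by positivity)]

/-- Averaging the derivative of the likelihood over a box-shaped prior: an estimator that is close
to the true coefficients `β` everywhere on the box has a large weighted correlation with the total
score for some `β`. -/
theorem le_of_weighted_score_le (hk : 1 ≤ k) {τ : ℝ} (hτ : 0 < τ) (hv : v ≠ 0) {n : ℕ}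
    {f : (Fin n → X × ℝ) → Fin k → ℝ} (hf : ∀ j, Measurable fun S => f S j)
    (hfτ : ∀ S j, |f S j| ≤ τ) {U V : ℝ}
    (hU : ∀ β : Fin k → ℝ, (∀ j, |β j| ≤ τ) →
      ∫ S, ∑ j, (τ ^ 2 - β j ^ 2) * (f S j - β j) * ∑ i, score ξ β j (S i)
        ∂(Measure.pi fun _ => regressionLaw ν ξ v β) ≤ U)
    (hV : ∀ β : Fin k → ℝ, (∀ j, |β j| ≤ τ) →
      -V ≤ ∫ S, ∑ j, β j * (f S j - β j) ∂(Measure.pi fun _ => regressionLaw ν ξ v β)) :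
    v * (2 * k * τ ^ 2 / 3 - 2 * V) ≤ U := by
  have hprob := isProbabilityMeasure_regressionLaw (ν := ν) (v := v) h.measurable
  have hv0 : (0 : ℝ) < v := NNReal.coe_pos.2 (pos_iff_ne_zero.2 hv)
  set D : (Fin k → ℝ) → Measure (Fin n → X × ℝ) :=
    fun β => Measure.pi fun _ => regressionLaw ν ξ v β with hD
  set Q : Measure (Fin n → X × ℝ) := Measure.pi fun _ => ν.prod volume with hQ
  set box : Set (Fin k → ℝ) := Set.Icc (fun _ => -τ) (fun _ => τ) with hbox
  set s : (Fin n → X × ℝ) → (Fin k → ℝ) → Fin k → ℝ :=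
    fun S β j => ∑ i, score ξ β j (S i) with hs
  -- Chosen so that `likelihood * φ` is the divergence in `β` of the field `(τ² - β_j²)(f_j - β_j) *
  -- likelihood`.
  set φ : (Fin n → X × ℝ) → (Fin k → ℝ) → ℝ := fun S β =>
    ∑ j, (-2 * β j * (f S j - β j) - (τ ^ 2 - β j ^ 2)
      + (τ ^ 2 - β j ^ 2) * (f S j - β j) * (s S β j / v)) with hφ
  have hsm : ∀ j, Measurable fun p : (Fin n → X × ℝ) × (Fin k → ℝ) => s p.1 p.2 j := fun j =>
    Finset.measurable_sum _ fun i _ => (measurable_score_uncurry h.measurable j).comp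
      (measurable_snd.prodMk ((measurable_pi_apply i).comp measurable_fst))
  have hβm : ∀ j, Measurable fun p : (Fin n → X × ℝ) × (Fin k → ℝ) => p.2 j := fun j =>
    (measurable_pi_apply j).comp measurable_snd
  have hfm : ∀ j, Measurable fun p : (Fin n → X × ℝ) × (Fin k → ℝ) => f p.1 j := fun j =>
    (hf j).comp measurable_fst
  have hφm : Measurable fun p : (Fin n → X × ℝ) × (Fin k → ℝ) => φ p.1 p.2 := by
    refine Finset.measurable_sum _ fun j _ => ?_
    exact ((((hβm j).const_mul (-2)).mul ((hfm j).sub (hβm j))).sub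
      (((hβm j).pow_const 2).const_sub _)).add
      (((((hβm j).pow_const 2).const_sub _).mul ((hfm j).sub (hβm j))).mul ((hsm j).div_const _))
  have hdiff : ∀ β : Fin k → ℝ, (∀ j, |β j| ≤ τ) → ∀ S j, |f S j - β j| ≤ 2 * τ :=
    fun β hβ S j => (abs_sub _ _).trans (by linarith [hfτ S j, hβ j])
  have hw : ∀ β : Fin k → ℝ, (∀ j, |β j| ≤ τ) → ∀ j,
      0 ≤ τ ^ 2 - β j ^ 2 ∧ τ ^ 2 - β j ^ 2 ≤ τ ^ 2 := fun β hβ j => by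
    have : β j ^ 2 ≤ τ ^ 2 := sq_le_sq' (by linarith [(abs_le.1 (hβ j)).1]) (abs_le.1 (hβ j)).2
    exact ⟨by linarith, by linarith [sq_nonneg (β j)]⟩
  have hφb : ∀ β : Fin k → ℝ, (∀ j, |β j| ≤ τ) → ∀ S,
      |φ S β| ≤ ∑ j, (5 * τ ^ 2 + 2 * τ ^ 3 / v * |s S β j|) := by
    intro β hβ S
    refine (Finset.abs_sum_le_sum_abs _ _).trans (Finset.sum_le_sum fun j _ => ?_)
    have a1 : |-2 * β j * (f S j - β j)| ≤ 4 * τ ^ 2 := by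
      rw [abs_mul, abs_mul, abs_neg, abs_two]
      have := mul_le_mul (hβ j) (hdiff β hβ S j) (abs_nonneg _) hτ.le
      nlinarith
    have a2 : |(τ ^ 2 - β j ^ 2) * (f S j - β j) * (s S β j / v)| ≤ 2 * τ ^ 3 / v * |s S β j| := by
      rw [abs_mul, abs_mul, abs_div, abs_of_pos hv0, abs_of_nonneg (hw β hβ j).1]
      have := mul_le_mul (hw β hβ j).2 (hdiff β hβ S j) (abs_nonneg _) (by positivity)
      calc _ ≤ (τ ^ 2 * (2 * τ)) * (|s S β j| / v) :=
            mul_le_mul_of_nonneg_right this (by positivity)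
        _ = _ := by ring
    have a3 : |τ ^ 2 - β j ^ 2| ≤ τ ^ 2 := by
      rw [abs_of_nonneg (hw β hβ j).1]; exact (hw β hβ j).2
    refine (abs_add_le _ _).trans (add_le_add ((abs_sub _ _).trans ?_) a2)
    linarith
  have hbi : ∀ β, Integrable (fun S => ∑ j, (5 * τ ^ 2 + 2 * τ ^ 3 / v * |s S β j|)) (D β) :=
    fun β => integrable_finsetSum _ fun j _ =>
      (integrable_const _).add ((h.integrable_totalScore β j).abs.const_mul _)
  have hφi : ∀ β : Fin k → ℝ, (∀ j, |β j| ≤ τ) → Integrable (fun S => φ S β) (D β) := fun β hβ =>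
    (hbi β).mono' (hφm.comp measurable_prodMk_right).aestronglyMeasurable
      (Filter.Eventually.of_forall fun S => hφb β hβ S)
  -- A bound uniform in `β`, since the law of the residuals does not depend on `β`; this supplies
  -- the joint integrability for Fubini.
  have hbint : ∀ β, ∫ S, ∑ j, (5 * τ ^ 2 + 2 * τ ^ 3 / v * |s S β j|) ∂(D β)
      ≤ ∑ _j : Fin k, (5 * τ ^ 2 + 2 * τ ^ 3 / v * √(n * v)) := fun β => by
    have hi : ∀ j, Integrable (fun S => 2 * τ ^ 3 / v * |s S β j|) (D β) := fun j =>
      (h.integrable_totalScore β j).abs.const_mul _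
    have hi' : ∀ j, Integrable (fun S => 5 * τ ^ 2 + 2 * τ ^ 3 / v * |s S β j|) (D β) := fun j =>
      (integrable_const _).add (hi j)
    rw [integral_finsetSum _ fun j _ => hi' j]
    refine Finset.sum_le_sum fun j _ => ?_
    rw [integral_add (integrable_const _) (hi j), integral_const_mul (2 * τ ^ 3 / v : ℝ)]
    have := h.integral_abs_totalScore_le (v := v) (n := n) β j
    simp only [integral_const, probReal_univ, one_smul]
    exact add_le_add_right (mul_le_mul_of_nonneg_left this
      (by positivity : 0 ≤ 2 * τ ^ 3 / (v : ℝ))) _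
  -- the likelihood-weighted integrand is integrable jointly
  have hHm : Measurable fun p : (Fin n → X × ℝ) × (Fin k → ℝ) =>
      likelihood ξ v p.2 p.1 * φ p.1 p.2 := (measurable_likelihood h.measurable).mul hφm
  have hbm : MeasurableSet box := measurableSet_Icc
  have hfin : IsFiniteMeasure (volume.restrict box) :=
    ⟨by rw [Measure.restrict_apply_univ]; exact isCompact_Icc.measure_lt_top⟩
  have hH : Integrable (fun p : (Fin n → X × ℝ) × (Fin k → ℝ) =>
      likelihood ξ v p.2 p.1 * φ p.1 p.2) (Q.prod (volume.restrict box)) := by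
    refine (integrable_prod_iff' hHm.aestronglyMeasurable).2 ⟨?_, ?_⟩
    · filter_upwards [ae_restrict_mem hbm] with β hβ
      exact (integrable_pi_regressionLaw_iff h.measurable hv β).1 (hφi β (mem_box_iff.1 hβ))
    · refine Integrable.of_bound
        (C := ∑ _j : Fin k, (5 * τ ^ 2 + 2 * τ ^ 3 / v * √(n * v))) ?_ ?_
      · exact (hHm.norm.comp measurable_swap).stronglyMeasurable.integral_prod_right'
          (ν := Q).aestronglyMeasurable
      · filter_upwards [ae_restrict_mem hbm] with β hβ
        rw [Real.norm_of_nonneg (integral_nonneg fun S => norm_nonneg _)]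
        have hβ' := mem_box_iff.1 hβ
        have e : ∀ S, ‖likelihood ξ v β S * φ S β‖ = likelihood ξ v β S * |φ S β| := fun S => by
          rw [norm_mul, Real.norm_of_nonneg (likelihood_nonneg _ _ _ _), Real.norm_eq_abs]
        simp only [e]
        rw [← integral_pi_regressionLaw h.measurable hv β fun S => |φ S β|]
        exact (integral_mono (hφi β hβ').abs (hbi β) (hφb β hβ')).trans (hbint β)
  -- the divergence theorem for a fixed sample
  have hdiv : ∀ S, ∫ β in box, likelihood ξ v β S * φ S β = 0 := by
    intro S
    have hp : ∀ a t : ℝ, HasDerivAt (fun t => (τ ^ 2 - t ^ 2) * (a - t))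
        (-2 * t * (a - t) - (τ ^ 2 - t ^ 2)) t := fun a t => by
      refine (((hasDerivAt_pow 2 t).const_sub (τ ^ 2)).mul
        ((hasDerivAt_id t).const_sub a)).congr_deriv ?_
      simp only [id, Nat.cast_ofNat]
      ring
    have hGd : ∀ (j : Fin k) (β : Fin k → ℝ), HasFDerivAt
        (fun β => (τ ^ 2 - β j ^ 2) * (f S j - β j) * likelihood ξ v β S)
        (((τ ^ 2 - β j ^ 2) * (f S j - β j)) • (likelihood ξ v β S •
        ∑ l, ((∑ i, score ξ β l (S i)) / v) •
          ContinuousLinearMap.proj (R := ℝ) (φ := fun _ : Fin k => ℝ) l)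
        + likelihood ξ v β S • ((-2 * β j * (f S j - β j) - (τ ^ 2 - β j ^ 2)) •
          ContinuousLinearMap.proj (R := ℝ) (φ := fun _ : Fin k => ℝ) j)) β := fun j β =>
      ((hp (f S j) (β j)).comp_hasFDerivAt (f := fun β : Fin k → ℝ => β j) β
        (ContinuousLinearMap.proj (R := ℝ) (φ := fun _ : Fin k => ℝ) j).hasFDerivAt).mul
        (hasFDerivAt_likelihood ξ v β S)
    have hlc : Continuous fun β => likelihood ξ v β S :=
      continuous_iff_continuousAt.2 fun β => (hasFDerivAt_likelihood ξ v β S).continuousAt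
    have hsc : ∀ j, Continuous fun β => ∑ i, score ξ β j (S i) := fun j =>
      continuous_finsetSum _ fun i _ => continuous_score ξ j (S i)
    have e : ∀ β, ∑ j, (((τ ^ 2 - β j ^ 2) * (f S j - β j)) • (likelihood ξ v β S •
        ∑ l, ((∑ i, score ξ β l (S i)) / v) •
          ContinuousLinearMap.proj (R := ℝ) (φ := fun _ : Fin k => ℝ) l)
        + likelihood ξ v β S • ((-2 * β j * (f S j - β j) - (τ ^ 2 - β j ^ 2)) •
          ContinuousLinearMap.proj (R := ℝ) (φ := fun _ : Fin k => ℝ) j)) (Pi.single j 1)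
        = likelihood ξ v β S * φ S β := by
      intro β
      rw [hφ, Finset.mul_sum]
      refine Finset.sum_congr rfl fun j _ => ?_
      simp only [_root_.add_apply, _root_.smul_apply, _root_.sum_apply,
        ContinuousLinearMap.proj_apply, Pi.single_eq_same, smul_eq_mul]
      rw [Finset.sum_eq_single j (fun l _ hl => by simp [hl]) (by simp), Pi.single_eq_same]
      ring
    have := integral_box_divergence_eq_zero hk hτ.le hGd
      (fun j β hj => by rcases hj with hj | hj <;> simp [hj]) (by
        have : Continuous fun β => likelihood ξ v β S * φ S β := by
          refine hlc.mul (continuous_finsetSum _ fun j _ => ?_)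
          have := hsc j
          fun_prop
        exact this.congr fun β => (e β).symm)
    rw [← this]
    exact integral_congr_ae (Filter.Eventually.of_forall fun β => (e β).symm)
  have hswap : ∫ β in box, ∫ S, likelihood ξ v β S * φ S β ∂Q = 0 := by
    rw [← integral_integral_swap (f := fun S β => likelihood ξ v β S * φ S β) hH]
    simp [hdiv]
  -- The three groups of terms in `φ` are controlled by `hV`, by `hU` and by the exact weight. As
  -- the left side integrates to zero over the box, the right side has nonnegative integral, which
  -- is the claim after division by the volume.
  have hpt : ∀ β ∈ box, ∫ S, likelihood ξ v β S * φ S β ∂Q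
      ≤ 2 * V + U / v - ∑ j, (τ ^ 2 - β j ^ 2) := by
    intro β hβ
    have hβ' := mem_box_iff.1 hβ
    rw [← integral_pi_regressionLaw h.measurable hv β fun S => φ S β]
    have hi1 : Integrable (fun S => ∑ j, β j * (f S j - β j)) (D β) :=
      integrable_finsetSum _ fun j _ => ((Integrable.of_bound (hf j).aestronglyMeasurable τ
        (Filter.Eventually.of_forall fun S => hfτ S j)).sub (integrable_const _)).const_mul _
    have hi2 : Integrable (fun S => ∑ j, (τ ^ 2 - β j ^ 2) * (f S j - β j) * s S β j) (D β) := by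
      refine integrable_finsetSum _ fun j _ => ?_
      refine (h.integrable_totalScore β j).bdd_mul (c := τ ^ 2 * (2 * τ))
        (((hf j).sub_const _).const_mul _).aestronglyMeasurable
        (Filter.Eventually.of_forall fun S => ?_)
      rw [Real.norm_eq_abs, abs_mul, abs_of_nonneg (hw β hβ' j).1]
      exact mul_le_mul (hw β hβ' j).2 (hdiff β hβ' S j) (abs_nonneg _) (by positivity)
    have e : ∀ S, φ S β = (-2) * (∑ j, β j * (f S j - β j))
        + (1 / v) * (∑ j, (τ ^ 2 - β j ^ 2) * (f S j - β j) * s S β j)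
        - ∑ j, (τ ^ 2 - β j ^ 2) := fun S => by
      rw [hφ, Finset.mul_sum, Finset.mul_sum, ← Finset.sum_add_distrib, ← Finset.sum_sub_distrib]
      exact Finset.sum_congr rfl fun j _ => by ring
    simp_rw [e]
    have hi3 := hi1.const_mul (-2)
    have hi4 := hi2.const_mul (1 / v : ℝ)
    have hi5 : Integrable (fun S => (-2) * (∑ j, β j * (f S j - β j))
        + (1 / v) * (∑ j, (τ ^ 2 - β j ^ 2) * (f S j - β j) * s S β j)) (D β) := hi3.add hi4
    rw [integral_sub hi5 (integrable_const _), integral_add hi3 hi4, integral_const_mul,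
      integral_const_mul]
    have b1 := hU β hβ'
    have b2 := hV β hβ'
    simp only [integral_const, probReal_univ, one_smul]
    have b3 := mul_le_mul_of_nonneg_left b1 (by positivity : (0 : ℝ) ≤ 1 / v)
    have b4 : U / v = 1 / v * U := by ring
    rw [b4]
    linarith
  have hwi : Integrable (fun β : Fin k → ℝ => ∑ j, (τ ^ 2 - β j ^ 2)) (volume.restrict box) :=
    (Continuous.continuousOn (by fun_prop)).integrableOn_compact isCompact_Icc
  have hle : ∫ β in box, ∫ S, likelihood ξ v β S * φ S β ∂Q
      ≤ ∫ β in box, (2 * V + U / v - ∑ j, (τ ^ 2 - β j ^ 2)) :=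
    integral_mono_ae hH.integral_prod_right ((integrable_const _).sub hwi)
      ((ae_restrict_iff' hbm).2 (Filter.Eventually.of_forall hpt))
  rw [hswap, integral_sub (integrable_const _) hwi, integral_box_weight hk hτ.le] at hle
  have hpos := volume_real_box_pos (k := k) hτ
  simp only [integral_const, smul_eq_mul, measureReal_restrict_apply_univ] at hle
  rw [← mul_sub] at hle
  have := nonneg_of_mul_nonneg_right hle hpos
  have h2 : 2 * k * τ ^ 2 / 3 - 2 * V ≤ U / v := by linarith
  rw [le_div_iff₀ hv0] at h2
  linarith

end OrthonormalFeatures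

end Bayes

/-! ### Lower bounds for private regression in `k` dimensions -/

section Minimax

open scoped NNReal

variable {X : Type*} [MeasurableSpace X] {k : ℕ} {ν : Measure X} [IsProbabilityMeasure ν]
  {ξ : X → Fin k → ℝ} {v : ℝ≥0}

/-- The weighted score of an example `z` against the estimate `w`. -/
def weightedScore (ξ : X → Fin k → ℝ) (τ : ℝ) (β w : Fin k → ℝ) (z : X × ℝ) : ℝ :=
  ∑ j, (τ ^ 2 - β j ^ 2) * (w j - β j) * score ξ β j z

theorem weight_nonneg {τ : ℝ} {β : Fin k → ℝ} (hβ : ∀ j, |β j| ≤ τ) (j : Fin k) :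
    0 ≤ τ ^ 2 - β j ^ 2 := by
  have := sq_le_sq' (by linarith [(abs_le.1 (hβ j)).1]) (abs_le.1 (hβ j)).2
  linarith

theorem abs_weight_mul_le {τ : ℝ} {β w : Fin k → ℝ} (hβ : ∀ j, |β j| ≤ τ)
    (hw : ∀ j, |w j| ≤ τ) (j : Fin k) : |(τ ^ 2 - β j ^ 2) * (w j - β j)| ≤ 2 * τ ^ 3 := by
  rw [abs_mul, abs_of_nonneg (weight_nonneg hβ j)]
  have h1 : |w j - β j| ≤ 2 * τ := (abs_sub _ _).trans (by linarith [hw j, hβ j])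
  calc _ ≤ τ ^ 2 * (2 * τ) :=
        mul_le_mul (by linarith [sq_nonneg (β j)]) h1 (abs_nonneg _) (by positivity)
    _ = _ := by ring

theorem weight_mul_sq_le {τ : ℝ} {β w : Fin k → ℝ} (hβ : ∀ j, |β j| ≤ τ) (j : Fin k) :
    ((τ ^ 2 - β j ^ 2) * (w j - β j)) ^ 2 ≤ τ ^ 4 * (w j - β j) ^ 2 := by
  rw [mul_pow]
  refine mul_le_mul_of_nonneg_right ?_ (sq_nonneg _)
  calc (τ ^ 2 - β j ^ 2) ^ 2 ≤ (τ ^ 2) ^ 2 :=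
        pow_le_pow_left₀ (weight_nonneg hβ j) (by linarith [sq_nonneg (β j)]) 2
    _ = _ := by ring

namespace OrthonormalFeatures

variable (h : OrthonormalFeatures ν ξ)
include h

/-- For a fixed output the weighted score is a linear combination of centred, uncorrelated scores of
variance `σ²`, so its `L¹` norm is at most `σ τ²` times the distance from the estimate to `β`. The
tracing bound and Jensen's inequality turn this into `√R`; the `δ` term is paid by the envelope `∑ 2
τ³ |score_j|`. -/
theorem integral_weightedScore_le_of_dp {W : Type*} [MeasurableSpace W] {n : ℕ}
    {M : Kernel (Fin n → X × ℝ) W} [IsMarkovKernel M] {ε δ : ℝ}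
    (hε : 0 < ε) (hε1 : ε < 1) (hδ : 0 ≤ δ)
    (hdp : ∀ S S' : Fin n → X × ℝ, (∃ i, ∀ j, j ≠ i → S j = S' j) → ∀ E, MeasurableSet E →
      M S E ≤ ENNReal.ofReal (Real.exp ε) * M S' E + ENNReal.ofReal δ)
    {σ τ : ℝ} (hσ : 0 ≤ σ) (hv : (v : ℝ) = σ ^ 2) (hτ : 0 ≤ τ)
    {u : W → Fin k → ℝ} (hu : ∀ j, Measurable fun w => u w j) (huτ : ∀ w j, |u w j| ≤ τ)
    {R : ℝ} (hR0 : 0 ≤ R) {β : Fin k → ℝ} (hβ : ∀ j, |β j| ≤ τ)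
    (hR : ∫ p, ∑ j, (u p.2 j - β j) ^ 2
      ∂((Measure.pi fun _ : Fin n => regressionLaw ν ξ v β) ⊗ₘ M) ≤ R) (i : Fin n) :
    ∫ p, weightedScore ξ τ β (u p.2) (p.1 i)
        ∂((Measure.pi fun _ : Fin n => regressionLaw ν ξ v β) ⊗ₘ M)
      ≤ 2 * ε * (σ * τ ^ 2 * √R) + 2 * (δ * (2 * τ ^ 3 * (k * σ))) := by
  have := isProbabilityMeasure_regressionLaw (ν := ν) (v := v) h.measurable β
  set P := regressionLaw ν ξ v β with hP
  have hN0 : ∀ w, 0 ≤ ∑ j, (u w j - β j) ^ 2 := fun w => Finset.sum_nonneg fun j _ => sq_nonneg _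
  have hNb : ∀ w, ∑ j, (u w j - β j) ^ 2 ≤ ∑ _j : Fin k, (2 * τ) ^ 2 := fun w =>
    Finset.sum_le_sum fun j _ => by
      rw [← sq_abs]
      exact pow_le_pow_left₀ (abs_nonneg _) ((abs_sub _ _).trans (by linarith [huτ w j, hβ j])) 2
  have hNm : Measurable fun w => ∑ j, (u w j - β j) ^ 2 :=
    Finset.measurable_sum _ fun j _ => ((hu j).sub_const _).pow_const 2
  have hNi2 : Integrable (fun p : (Fin n → X × ℝ) × W => ∑ j, (u p.2 j - β j) ^ 2)
      ((Measure.pi fun _ => P) ⊗ₘ M) :=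
    Integrable.of_bound (hNm.comp measurable_snd).aestronglyMeasurable _
      (Filter.Eventually.of_forall fun p => by
        rw [Real.norm_of_nonneg (hN0 _)]; exact hNb p.2)
  have hNi : Integrable (fun p : (Fin n → X × ℝ) × W => √(∑ j, (u p.2 j - β j) ^ 2))
      ((Measure.pi fun _ => P) ⊗ₘ M) :=
    Integrable.of_bound (hNm.comp measurable_snd).sqrt.aestronglyMeasurable
      (√(∑ _j : Fin k, (2 * τ) ^ 2)) (Filter.Eventually.of_forall fun p => by
        rw [Real.norm_of_nonneg (Real.sqrt_nonneg _)]
        exact Real.sqrt_le_sqrt (hNb p.2))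
  have hNle : ∫ p : (Fin n → X × ℝ) × W, √(∑ j, (u p.2 j - β j) ^ 2)
      ∂((Measure.pi fun _ => P) ⊗ₘ M) ≤ √R := by
    have := integral_abs_le_of_integral_sq_le hNi (by simpa only [Real.sq_sqrt (hN0 _)] using hNi2)
      (Real.sqrt_nonneg R) (by
        rw [Real.sq_sqrt hR0]
        simpa only [Real.sq_sqrt (hN0 _)] using hR)
    simpa only [abs_of_nonneg (Real.sqrt_nonneg _)] using this
  have hA : Measurable (Function.uncurry fun z w => weightedScore ξ τ β (u w) z) := by
    simp only [Function.uncurry_def, weightedScore]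
    refine Finset.measurable_sum _ fun j _ => ?_
    have h1 : Measurable fun p : (X × ℝ) × W => (τ ^ 2 - β j ^ 2) * (u p.2 j - β j) :=
      (((hu j).comp measurable_snd).sub_const _).const_mul _
    exact h1.mul ((measurable_score h.measurable β j).comp measurable_fst)
  have hTi : Integrable (fun z => ∑ j, 2 * τ ^ 3 * |score ξ β j z|) P :=
    integrable_finsetSum _ fun j _ => (h.integrable_score β j).abs.const_mul _
  have hT : ∫ z, ∑ j, 2 * τ ^ 3 * |score ξ β j z| ∂P ≤ 2 * τ ^ 3 * (k * σ) := by
    rw [integral_finsetSum _ fun j _ => (h.integrable_score β j).abs.const_mul _]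
    calc _ ≤ ∑ _j : Fin k, 2 * τ ^ 3 * σ := Finset.sum_le_sum fun j _ => by
          rw [integral_const_mul]
          exact mul_le_mul_of_nonneg_left (h.integral_abs_score_le hσ hv β j) (by positivity)
      _ = _ := by
          simp only [Finset.sum_const, Finset.card_univ, Fintype.card_fin, nsmul_eq_mul]
          ring
  refine (integral_coord_le_of_dp hε hε1 hδ hdp i hA hTi ?_ ?_
    (b := fun w => σ * τ ^ 2 * √(∑ j, (u w j - β j) ^ 2)) ?_ (hNi.const_mul _)).trans ?_
  · intro z w
    refine (Finset.abs_sum_le_sum_abs _ _).trans (Finset.sum_le_sum fun j _ => ?_)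
    rw [abs_mul]
    exact mul_le_mul_of_nonneg_right (abs_weight_mul_le hβ (huτ w) j) (abs_nonneg _)
  · exact fun w => h.integral_sum_score β _
  · intro w
    refine (h.integral_abs_sum_score_le hσ hv β _).trans ?_
    rw [mul_assoc]
    refine mul_le_mul_of_nonneg_left ?_ hσ
    refine Real.sqrt_le_iff.2 ⟨by positivity, ?_⟩
    rw [mul_pow, Real.sq_sqrt (hN0 w), Finset.mul_sum]
    refine Finset.sum_le_sum fun j _ => (weight_mul_sq_le hβ j).trans_eq ?_
    ring
  · rw [integral_const_mul]
    have h1 := mul_le_mul_of_nonneg_left hNle (by positivity : 0 ≤ σ * τ ^ 2)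
    have h2 := mul_le_mul_of_nonneg_left h1 (by positivity : 0 ≤ 2 * ε)
    have h3 := mul_le_mul_of_nonneg_left hT hδ
    linarith

/-- Minimax lower bounds for private linear regression over the box `[-τ, τ]^k`: the uniform bound
`R` on the squared error either exceeds a constant multiple of the size of the box, or both the
privacy rate and the statistical rate. -/
theorem private_regression_lower_bound {W : Type*} [MeasurableSpace W] {n : ℕ}
    {M : Kernel (Fin n → X × ℝ) W} [IsMarkovKernel M] {ε δ : ℝ}
    (hε : 0 < ε) (hε1 : ε < 1) (hδ : 0 ≤ δ) (hn : 1 ≤ n) (hnδ : 24 * (n * δ) ≤ 1)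
    (hdp : ∀ S S' : Fin n → X × ℝ, (∃ i, ∀ j, j ≠ i → S j = S' j) → ∀ E, MeasurableSet E →
      M S E ≤ ENNReal.ofReal (Real.exp ε) * M S' E + ENNReal.ofReal δ)
    (hk : 1 ≤ k) {σ τ : ℝ} (hσ : 0 < σ) (hv : (v : ℝ) = σ ^ 2) (hτ : 0 < τ) (hτσ : τ ≤ σ)
    {u : W → Fin k → ℝ} (hu : ∀ j, Measurable fun w => u w j) (huτ : ∀ w j, |u w j| ≤ τ)
    {R : ℝ} (hR0 : 0 ≤ R) (hRτ : 36 * R ≤ k * τ ^ 2)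
    (hR : ∀ β : Fin k → ℝ, (∀ j, |β j| ≤ τ) → ∫ p, ∑ j, (u p.2 j - β j) ^ 2
      ∂((Measure.pi fun _ : Fin n => regressionLaw ν ξ v β) ⊗ₘ M) ≤ R) :
    σ ^ 2 * k ^ 2 ≤ 144 * (n ^ 2 * ε ^ 2) * R ∧ σ ^ 2 * k ≤ 9 * n * R := by
  have hprob := isProbabilityMeasure_regressionLaw (ν := ν) (v := v) h.measurable
  have hv0 : v ≠ 0 := by
    rintro rfl
    simp only [NNReal.coe_zero] at hv
    exact (pow_pos hσ 2).ne hv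
  have hk0 : (0 : ℝ) < k := by exact_mod_cast hk
  have hn0 : (0 : ℝ) < n := by exact_mod_cast hn
  set J : (Fin k → ℝ) → Measure ((Fin n → X × ℝ) × W) :=
    fun β => (Measure.pi fun _ : Fin n => regressionLaw ν ξ v β) ⊗ₘ M with hJ
  -- The algorithm's randomness is averaged out: the correlations are linear in the estimate, so its
  -- conditional mean given the data has the same ones.
  set f : (Fin n → X × ℝ) → Fin k → ℝ := fun S j => ∫ w, u w j ∂(M S) with hf
  have hui : ∀ S j, Integrable (fun w => u w j) (M S) := fun S j =>
    Integrable.of_bound (hu j).aestronglyMeasurable τ (Filter.Eventually.of_forall fun w => huτ w j)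
  have hus : ∀ S j b, Integrable (fun w => u w j - b) (M S) := fun S j b =>
    (hui S j).sub (integrable_const _)
  have hfm : ∀ j, Measurable fun S => f S j := fun j =>
    ((hu j).stronglyMeasurable.integral_kernel (κ := M)).measurable
  have hfτ : ∀ S j, |f S j| ≤ τ := fun S j => by
    have := norm_integral_le_of_norm_le_const (μ := M S) (f := fun w => u w j) (C := τ)
      (Filter.Eventually.of_forall fun w => huτ w j)
    simpa using this
  have hud : ∀ (β : Fin k → ℝ) (j : Fin k), Integrable
      (fun p : (Fin n → X × ℝ) × W => u p.2 j - β j) (J β) := fun β j =>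
    (Integrable.of_bound ((hu j).comp measurable_snd).aestronglyMeasurable τ
      (Filter.Eventually.of_forall fun p => huτ p.2 j)).sub (integrable_const _)
  have hud2 : ∀ β : Fin k → ℝ, (∀ j, |β j| ≤ τ) → Integrable
      (fun p : (Fin n → X × ℝ) × W => ∑ j, (u p.2 j - β j) ^ 2) (J β) := fun β hβ =>
    integrable_finsetSum _ fun j _ =>
      Integrable.of_bound ((((hu j).comp measurable_snd).sub_const _).pow_const 2).aestronglyMeasurable
        ((2 * τ) ^ 2) (Filter.Eventually.of_forall fun p => by
          rw [Real.norm_eq_abs, abs_pow]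
          exact pow_le_pow_left₀ (abs_nonneg _)
            ((abs_sub _ _).trans (by linarith [huτ p.2 j, hβ j])) 2)
  have hfst : ∀ β, MeasurePreserving Prod.fst (J β)
      (Measure.pi fun _ : Fin n => regressionLaw ν ξ v β) := fun β =>
    ⟨measurable_fst, Measure.fst_compProd _ _⟩
  have hsi : ∀ β j, Integrable (fun p : (Fin n → X × ℝ) × W => ∑ i, score ξ β j (p.1 i)) (J β) :=
    fun β j => (hfst β).integrable_comp_of_integrable (h.integrable_totalScore β j)
  have hprodi : ∀ β : Fin k → ℝ, (∀ j, |β j| ≤ τ) → ∀ j, Integrable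
      (fun p : (Fin n → X × ℝ) × W => (τ ^ 2 - β j ^ 2) * (u p.2 j - β j)
        * ∑ i, score ξ β j (p.1 i)) (J β) := fun β hβ j =>
    (hsi β j).bdd_mul (c := 2 * τ ^ 3)
      ((((hu j).comp measurable_snd).sub_const _).const_mul _).aestronglyMeasurable
      (Filter.Eventually.of_forall fun p => abs_weight_mul_le hβ (huτ p.2) j)
  have hΨ : ∀ β : Fin k → ℝ, (∀ j, |β j| ≤ τ) →
      ∫ S, ∑ j, (τ ^ 2 - β j ^ 2) * (f S j - β j) * ∑ i, score ξ β j (S i)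
        ∂(Measure.pi fun _ => regressionLaw ν ξ v β)
      = ∫ p, ∑ j, (τ ^ 2 - β j ^ 2) * (u p.2 j - β j) * ∑ i, score ξ β j (p.1 i) ∂(J β) := by
    intro β hβ
    rw [hJ, Measure.integral_compProd (integrable_finsetSum _ fun j _ => hprodi β hβ j)]
    refine integral_congr_ae (Filter.Eventually.of_forall fun S => ?_)
    simp only
    rw [integral_finsetSum _ fun j _ =>
      ((hus S j _).const_mul _).mul_const _]
    refine Finset.sum_congr rfl fun j _ => ?_
    rw [integral_mul_const, integral_const_mul, integral_sub (hui S j) (integrable_const _)]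
    simp [hf]
  have hVint : ∀ β : Fin k → ℝ,
      ∫ S, ∑ j, β j * (f S j - β j) ∂(Measure.pi fun _ => regressionLaw ν ξ v β)
      = ∫ p, ∑ j, β j * (u p.2 j - β j) ∂(J β) := by
    intro β
    rw [hJ, Measure.integral_compProd
      (integrable_finsetSum _ fun j _ => (hud β j).const_mul _)]
    refine integral_congr_ae (Filter.Eventually.of_forall fun S => ?_)
    simp only
    rw [integral_finsetSum _ fun j _ => (hus S j _).const_mul _]
    refine Finset.sum_congr rfl fun j _ => ?_
    rw [integral_const_mul, integral_sub (hui S j) (integrable_const _)]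
    simp [hf]
  have hV : ∀ β : Fin k → ℝ, (∀ j, |β j| ≤ τ) → -(k * τ ^ 2 / 6) ≤
      ∫ S, ∑ j, β j * (f S j - β j) ∂(Measure.pi fun _ => regressionLaw ν ξ v β) := by
    intro β hβ
    rw [hVint]
    -- Weighted AM-GM with weights `1/12` and `3`: since `36 R ≤ k τ²`, each of the two terms costs
    -- at most `k τ² / 12`.
    have hpt : ∀ p : (Fin n → X × ℝ) × W,
        -(k * τ ^ 2 / 12) - 3 * ∑ j, (u p.2 j - β j) ^ 2 ≤ ∑ j, β j * (u p.2 j - β j) := by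
      intro p
      have hs : ∑ j, β j ^ 2 ≤ k * τ ^ 2 := by
        calc _ ≤ ∑ _j : Fin k, τ ^ 2 := Finset.sum_le_sum fun j _ => by
              linarith [weight_nonneg hβ j]
          _ = _ := by simp
      have : ∑ j, (-(1 / 12) * β j ^ 2 - 3 * (u p.2 j - β j) ^ 2) ≤ ∑ j, β j * (u p.2 j - β j) :=
        Finset.sum_le_sum fun j _ => by nlinarith [sq_nonneg (β j + 6 * (u p.2 j - β j))]
      rw [Finset.sum_sub_distrib, ← Finset.mul_sum, ← Finset.mul_sum] at this
      linarith
    have hi3 := (hud2 β hβ).const_mul 3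
    have hi4 : Integrable (fun p : (Fin n → X × ℝ) × W =>
        -(k * τ ^ 2 / 12) - 3 * ∑ j, (u p.2 j - β j) ^ 2) (J β) := (integrable_const _).sub hi3
    have := integral_mono hi4
      (integrable_finsetSum _ fun j _ => (hud β j).const_mul (β j)) hpt
    refine le_trans ?_ this
    rw [integral_sub (integrable_const _) hi3, integral_const_mul]
    have := hR β hβ
    simp only [integral_const, probReal_univ, one_smul]
    linarith
  -- With `V = k τ² / 6`, half of the main term `2 k τ² / 3` survives.
  have main : ∀ U : ℝ, (∀ β : Fin k → ℝ, (∀ j, |β j| ≤ τ) →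
      ∫ p, ∑ j, (τ ^ 2 - β j ^ 2) * (u p.2 j - β j) * ∑ i, score ξ β j (p.1 i) ∂(J β) ≤ U) →
      σ ^ 2 * (k * τ ^ 2 / 3) ≤ U := by
    intro U hU
    have := h.le_of_weighted_score_le hk hτ hv0 hfm hfτ
      (fun β hβ => (hΨ β hβ).trans_le (hU β hβ)) hV
    rw [hv] at this
    linarith
  constructor
  · have hU := main (n * (2 * ε * (σ * τ ^ 2 * √R) + 2 * (δ * (2 * τ ^ 3 * (k * σ)))))
      fun β hβ => by
        have e : ∀ p : (Fin n → X × ℝ) × W,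
            ∑ j, (τ ^ 2 - β j ^ 2) * (u p.2 j - β j) * ∑ i, score ξ β j (p.1 i)
            = ∑ i, weightedScore ξ τ β (u p.2) (p.1 i) := fun p => by
          simp only [weightedScore, Finset.mul_sum]
          exact Finset.sum_comm
        have hwi : ∀ i, Integrable (fun p : (Fin n → X × ℝ) × W =>
            weightedScore ξ τ β (u p.2) (p.1 i)) (J β) := fun i =>
          integrable_finsetSum _ fun j _ =>
            (integrable_comp_coord i (h.integrable_score β j)).bdd_mul (c := 2 * τ ^ 3)
              ((((hu j).comp measurable_snd).sub_const _).const_mul _).aestronglyMeasurable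
              (Filter.Eventually.of_forall fun p => abs_weight_mul_le hβ (huτ p.2) j)
        simp_rw [e]
        rw [integral_finsetSum _ fun i _ => hwi i]
        calc _ ≤ ∑ _i : Fin n, (2 * ε * (σ * τ ^ 2 * √R) + 2 * (δ * (2 * τ ^ 3 * (k * σ)))) :=
              Finset.sum_le_sum fun i _ => h.integral_weightedScore_le_of_dp hε hε1 hδ hdp hσ.le hv
                hτ.le hu huτ hR0 hβ (hR β hβ) i
          _ = _ := by
            simp only [Finset.sum_const, Finset.card_univ, Fintype.card_fin, nsmul_eq_mul]
    -- Here `τ ≤ σ` and `24 n δ ≤ 1` enter: the total `δ` contribution uses up at most half of the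
    -- lower bound from `main`.
    have h1 : n * (2 * (δ * (2 * τ ^ 3 * (k * σ)))) ≤ σ * τ ^ 2 * (σ * k / 6) := by
      have : n * δ * τ ≤ σ / 24 := by
        calc n * δ * τ ≤ 1 / 24 * τ := mul_le_mul_of_nonneg_right (by linarith) hτ.le
          _ ≤ σ / 24 := by linarith
      have := mul_le_mul_of_nonneg_left this (by positivity : 0 ≤ 4 * (τ ^ 2 * (k * σ)))
      nlinarith
    have h2 : σ * τ ^ 2 * (σ * k / 6) ≤ σ * τ ^ 2 * (2 * (n * ε * √R)) := by
      rw [mul_add] at hU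
      nlinarith
    have h3 := le_of_mul_le_mul_left h2 (by positivity)
    have h4 : σ * k ≤ 12 * (n * ε * √R) := by linarith
    calc σ ^ 2 * k ^ 2 = (σ * k) ^ 2 := by ring
      _ ≤ (12 * (n * ε * √R)) ^ 2 := pow_le_pow_left₀ (by positivity) h4 2
      _ = 144 * (n ^ 2 * ε ^ 2) * √R ^ 2 := by ring
      _ = _ := by rw [Real.sq_sqrt hR0]
  -- No privacy is used here. The AM-GM weights are such that the second moment of the total scores
  -- contributes `σ² k τ² / 6`, again half of the lower bound from `main`.
  · have hU := main (3 * n * τ ^ 2 / 2 * R + σ ^ 2 * (k * τ ^ 2 / 6)) fun β hβ => by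
      have hs2 : ∀ j, Integrable (fun p : (Fin n → X × ℝ) × W =>
          (∑ i, score ξ β j (p.1 i)) ^ 2) (J β) := fun j =>
        (hfst β).integrable_comp_of_integrable (h.memLp_totalScore β j).integrable_sq
      have hpt : ∀ p : (Fin n → X × ℝ) × W,
          ∑ j, (τ ^ 2 - β j ^ 2) * (u p.2 j - β j) * ∑ i, score ξ β j (p.1 i)
          ≤ 3 * n * τ ^ 2 / 2 * ∑ j, (u p.2 j - β j) ^ 2
            + τ ^ 2 / (6 * n) * ∑ j, (∑ i, score ξ β j (p.1 i)) ^ 2 := by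
        intro p
        rw [Finset.mul_sum, Finset.mul_sum, ← Finset.sum_add_distrib]
        refine Finset.sum_le_sum fun j _ => ?_
        have a1 := weight_mul_sq_le (w := u p.2) hβ j
        generalize (τ ^ 2 - β j ^ 2) * (u p.2 j - β j) = a at *
        generalize ∑ i, score ξ β j (p.1 i) = b
        have a2 := sq_nonneg (3 * n * a - τ ^ 2 * b)
        have a3 : 3 * n * a ^ 2 / (2 * τ ^ 2) ≤ 3 * n * τ ^ 2 / 2 * (u p.2 j - β j) ^ 2 := by
          rw [div_le_iff₀ (by positivity)]
          have := mul_le_mul_of_nonneg_left a1 (by positivity : (0 : ℝ) ≤ 3 * n)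
          nlinarith
        have a4 : a * b ≤ 3 * n * a ^ 2 / (2 * τ ^ 2) + τ ^ 2 / (6 * n) * b ^ 2 := by
          have : 3 * n * a ^ 2 / (2 * τ ^ 2) + τ ^ 2 / (6 * n) * b ^ 2 - a * b
              = (3 * n * a - τ ^ 2 * b) ^ 2 / (6 * n * τ ^ 2) := by
            field_simp
            ring
          have : 0 ≤ (3 * n * a - τ ^ 2 * b) ^ 2 / (6 * n * τ ^ 2) := by positivity
          linarith
        linarith
      have hs3 : ∀ j, ∫ p, (∑ i, score ξ β j (p.1 i)) ^ 2 ∂(J β) = n * v := fun j => by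
        have hm : Measurable fun S : Fin n → X × ℝ => (∑ i, score ξ β j (S i)) ^ 2 :=
          (h.measurable_totalScore β j).pow_const 2
        have := integral_map (μ := J β) (hfst β).measurable.aemeasurable hm.aestronglyMeasurable
        rw [(hfst β).map_eq, h.integral_totalScore_sq] at this
        exact this.symm
      have i1 := (hud2 β hβ).const_mul (3 * n * τ ^ 2 / 2)
      have i2 := (integrable_finsetSum Finset.univ fun j _ => hs2 j).const_mul (τ ^ 2 / (6 * n))
      have i3 : Integrable (fun p : (Fin n → X × ℝ) × W =>
          3 * n * τ ^ 2 / 2 * ∑ j, (u p.2 j - β j) ^ 2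
            + τ ^ 2 / (6 * n) * ∑ j, (∑ i, score ξ β j (p.1 i)) ^ 2) (J β) := i1.add i2
      refine (integral_mono (integrable_finsetSum _ fun j _ => hprodi β hβ j) i3 hpt).trans ?_
      rw [integral_add i1 i2, integral_const_mul, integral_const_mul,
        integral_finsetSum _ fun j _ => hs2 j, Finset.sum_congr rfl fun j _ => hs3 j]
      have h1 := mul_le_mul_of_nonneg_left (hR β hβ)
        (by positivity : (0 : ℝ) ≤ 3 * n * τ ^ 2 / 2)
      have h2 : τ ^ 2 / (6 * n) * ∑ _j : Fin k, (n * v : ℝ) = σ ^ 2 * (k * τ ^ 2 / 6) := by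
        simp only [Finset.sum_const, Finset.card_univ, Fintype.card_fin, nsmul_eq_mul, hv]
        field_simp
      rw [h2]
      linarith
    have h1 : τ ^ 2 * (σ ^ 2 * k) ≤ τ ^ 2 * (9 * n * R) := by nlinarith
    exact le_of_mul_le_mul_left h1 (by positivity)

end OrthonormalFeatures

end Minimax

/-! ### Matrices with orthonormal columns -/

section Columns

variable {d k : ℕ}

/-- The `j`-th column of a matrix, as a Euclidean vector. -/
def column (B : Matrix (Fin d) (Fin k) ℝ) (j : Fin k) : EuclideanSpace ℝ (Fin d) :=
  WithLp.toLp 2 fun i => B i j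

theorem applyMat_eq_sum (B : Matrix (Fin d) (Fin k) ℝ) (a : EuclideanSpace ℝ (Fin k)) :
    applyMat B a = ∑ j, a j • column B j := by
  ext i
  simp [applyMat, column, Matrix.mulVec, dotProduct, mul_comm]

theorem inner_column (A B : Matrix (Fin d) (Fin k) ℝ) (i j : Fin k) :
    inner ℝ (column A i) (column B j) = (A.transpose * B) i j := by
  simp [column, PiLp.inner_apply, Matrix.mul_apply, mul_comm]

theorem orthonormalCols_iff {B : Matrix (Fin d) (Fin k) ℝ} :
    OrthonormalCols B ↔ Orthonormal ℝ (column B) := by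
  rw [orthonormal_iff_ite, OrthonormalCols, ← Matrix.ext_iff]
  simp only [inner_column, Matrix.one_apply]

theorem toEuclideanCLM_mul_transpose (B : Matrix (Fin d) (Fin k) ℝ)
    (x : EuclideanSpace ℝ (Fin d)) :
    Matrix.toEuclideanCLM (n := Fin d) (𝕜 := ℝ) (B * B.transpose) x
      = ∑ j, inner ℝ (column B j) x • column B j := by
  ext i
  rw [Matrix.ofLp_toEuclideanCLM, ← Matrix.mulVec_mulVec]
  simp [column, Matrix.mulVec, dotProduct, PiLp.inner_apply, mul_comm]

theorem inner_applyMat {B : Matrix (Fin d) (Fin k) ℝ} (hB : OrthonormalCols B)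
    (a : EuclideanSpace ℝ (Fin k)) (j : Fin k) : inner ℝ (column B j) (applyMat B a) = a j := by
  rw [applyMat_eq_sum, (orthonormalCols_iff.1 hB).inner_right_fintype]

theorem norm_applyMat_sq {B : Matrix (Fin d) (Fin k) ℝ} (hB : OrthonormalCols B)
    (a : EuclideanSpace ℝ (Fin k)) : ‖applyMat B a‖ ^ 2 = ∑ j, a j ^ 2 := by
  rw [← real_inner_self_eq_norm_sq]
  nth_rewrite 1 [applyMat_eq_sum]
  rw [sum_inner]
  exact Finset.sum_congr rfl fun j _ => by rw [real_inner_smul_left, inner_applyMat hB, sq]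

end Columns

/-! ### Rotating one column out of the subspace -/

section Tilt

variable {d k : ℕ}

theorem exists_unit_orthogonal (hkd : k < d) (B : Matrix (Fin d) (Fin k) ℝ) :
    ∃ b : EuclideanSpace ℝ (Fin d), ‖b‖ = 1 ∧ ∀ j, inner ℝ (column B j) b = 0 := by
  set s := Submodule.span ℝ (Set.range (column B)) with hs
  have hne : sᗮ ≠ ⊥ := by
    intro h
    have htop : s = ⊤ := (Submodule.orthogonal_eq_bot_iff).1 h
    have h1 : Module.finrank ℝ s ≤ k :=
      (finrank_range_le_card (R := ℝ) (column B)).trans_eq (Fintype.card_fin k)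
    rw [htop, finrank_top, finrank_euclideanSpace, Fintype.card_fin] at h1
    omega
  obtain ⟨x, hx, hx0⟩ := Submodule.exists_mem_ne_zero_of_ne_bot hne
  refine ⟨‖x‖⁻¹ • x, norm_smul_inv_norm hx0, fun j => ?_⟩
  rw [inner_smul_right, (Submodule.mem_orthogonal s x).1 hx _ (Submodule.subset_span ⟨j, rfl⟩),
    mul_zero]

/-- Replace column `j₀` of `B` by `√(1 - γ²)` times itself plus `γ b`. -/
def tilt (B : Matrix (Fin d) (Fin k) ℝ) (j₀ : Fin k) (b : EuclideanSpace ℝ (Fin d)) (γ : ℝ) :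
    Matrix (Fin d) (Fin k) ℝ :=
  fun i j => if j = j₀ then √(1 - γ ^ 2) * B i j₀ + γ * b i else B i j

theorem column_tilt_self (B : Matrix (Fin d) (Fin k) ℝ) (j₀ : Fin k)
    (b : EuclideanSpace ℝ (Fin d)) (γ : ℝ) :
    column (tilt B j₀ b γ) j₀ = √(1 - γ ^ 2) • column B j₀ + γ • b := by
  ext i
  simp [column, tilt]

theorem column_tilt_of_ne (B : Matrix (Fin d) (Fin k) ℝ) {j₀ j : Fin k} (hj : j ≠ j₀)
    (b : EuclideanSpace ℝ (Fin d)) (γ : ℝ) : column (tilt B j₀ b γ) j = column B j := by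
  ext i
  simp [column, tilt, hj]

variable {B : Matrix (Fin d) (Fin k) ℝ} {b : EuclideanSpace ℝ (Fin d)} {γ : ℝ}

theorem orthonormalCols_tilt (hB : OrthonormalCols B) (hb : ‖b‖ = 1)
    (hBb : ∀ j, inner ℝ (column B j) b = 0) (hγ0 : 0 ≤ γ) (hγ : γ ≤ 1) (j₀ : Fin k) :
    OrthonormalCols (tilt B j₀ b γ) := by
  have hB' := orthonormal_iff_ite.1 (orthonormalCols_iff.1 hB)
  have hbB : ∀ j, inner ℝ b (column B j) = 0 := fun j => by rw [real_inner_comm, hBb]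
  have hbb : inner ℝ b b = (1 : ℝ) := by rw [real_inner_self_eq_norm_sq, hb, one_pow]
  have hs : √(1 - γ ^ 2) * √(1 - γ ^ 2) = 1 - γ ^ 2 :=
    Real.mul_self_sqrt (by nlinarith)
  rw [orthonormalCols_iff, orthonormal_iff_ite]
  intro i j
  by_cases hi : i = j₀ <;> by_cases hj : j = j₀
  · subst hi hj
    simp only [column_tilt_self, inner_add_left, inner_add_right, real_inner_smul_left,
      real_inner_smul_right, hB', hBb, hbB, hbb, if_true]
    linarith
  · subst hi
    rw [if_neg (Ne.symm hj)]
    simp [column_tilt_self, column_tilt_of_ne B hj, inner_add_left, real_inner_smul_left, hB', hbB,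
      Ne.symm hj]
  · subst hj
    rw [if_neg hi]
    simp [column_tilt_self, column_tilt_of_ne B hi, inner_add_right, real_inner_smul_right, hB',
      hBb, hi]
  · rw [column_tilt_of_ne B hi, column_tilt_of_ne B hj, hB']

/-- The two projections differ only on the plane spanned by column `j₀` and `b`, where the
difference is `γ` times a reflection; Bessel's inequality handles the remaining directions. -/
theorem sinTheta_tilt_le (hB : OrthonormalCols B) (hb : ‖b‖ = 1)
    (hBb : ∀ j, inner ℝ (column B j) b = 0) (hγ0 : 0 ≤ γ) (hγ : γ ≤ 1) (j₀ : Fin k) :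
    sinTheta (tilt B j₀ b γ) B ≤ γ := by
  have hB' := orthonormal_iff_ite.1 (orthonormalCols_iff.1 hB)
  have hbB : inner ℝ b (column B j₀) = 0 := by rw [real_inner_comm, hBb]
  have hbb : inner ℝ b b = (1 : ℝ) := by rw [real_inner_self_eq_norm_sq, hb, one_pow]
  have hBB : inner ℝ (column B j₀) (column B j₀) = (1 : ℝ) := by rw [hB', if_pos rfl]
  set c := √(1 - γ ^ 2) with hc
  have hs : c ^ 2 = 1 - γ ^ 2 := Real.sq_sqrt (by nlinarith)
  refine ContinuousLinearMap.opNorm_le_bound _ hγ0 fun x => ?_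
  set p := inner ℝ (column B j₀) x with hp
  set q := inner ℝ b x with hq
  have e : Matrix.toEuclideanCLM (n := Fin d) (𝕜 := ℝ)
      (tilt B j₀ b γ * (tilt B j₀ b γ).transpose - B * B.transpose) x
      = (γ * (c * q - γ * p)) • column B j₀ + (γ * (c * p + γ * q)) • b := by
    rw [map_sub, _root_.sub_apply, toEuclideanCLM_mul_transpose, toEuclideanCLM_mul_transpose,
      ← Finset.sum_sub_distrib, Finset.sum_eq_single j₀]
    · rw [column_tilt_self, inner_add_left, real_inner_smul_left, real_inner_smul_left, ← hp, ← hq,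
        ← hc, smul_add, smul_smul, smul_smul]
      have : γ * (c * q - γ * p) = (c * p + γ * q) * c - p := by
        linear_combination (-p) * hs
      rw [this, sub_smul, mul_comm γ (c * p + γ * q)]
      abel
    · intro j _ hj
      rw [column_tilt_of_ne B hj, sub_self]
    · simp
  have hort : Orthonormal ℝ ![column B j₀, b] := by
    rw [orthonormal_iff_ite]
    intro i j
    fin_cases i <;> fin_cases j <;> simp [hbB, hBb, hb, (orthonormalCols_iff.1 hB).1 j₀]
  have hbes : p ^ 2 + q ^ 2 ≤ ‖x‖ ^ 2 := by
    have := hort.sum_inner_products_le (s := Finset.univ) x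
    simpa [Fin.sum_univ_two, ← hp, ← hq] using this
  rw [e]
  refine abs_le_of_sq_le_sq' ?_ (by positivity) |>.2
  rw [← real_inner_self_eq_norm_sq]
  simp only [inner_add_left, inner_add_right, real_inner_smul_left, real_inner_smul_right, hBB, hbb,
    hbB, hBb]
  calc _ = γ ^ 2 * ((c ^ 2 + γ ^ 2) * (p ^ 2 + q ^ 2)) := by ring
    _ = γ ^ 2 * (p ^ 2 + q ^ 2) := by rw [hs]; ring
    _ ≤ γ ^ 2 * ‖x‖ ^ 2 := mul_le_mul_of_nonneg_left hbes (sq_nonneg γ)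
    _ = _ := by ring

/-- Pairing with `b` kills the span of `B` and leaves exactly `γ`. -/
theorem sq_le_norm_tilt_sub_sq (hb : ‖b‖ = 1) (hBb : ∀ j, inner ℝ (column B j) b = 0)
    (j₀ : Fin k) (a : EuclideanSpace ℝ (Fin k)) :
    γ ^ 2 ≤ ‖applyMat (tilt B j₀ b γ) (EuclideanSpace.single j₀ 1) - applyMat B a‖ ^ 2 := by
  have hbB : ∀ j, inner ℝ b (column B j) = 0 := fun j => by rw [real_inner_comm, hBb]
  have hbb : inner ℝ b b = (1 : ℝ) := by rw [real_inner_self_eq_norm_sq, hb, one_pow]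
  have h1 : applyMat (tilt B j₀ b γ) (EuclideanSpace.single j₀ 1)
      = √(1 - γ ^ 2) • column B j₀ + γ • b := by
    rw [applyMat_eq_sum, Finset.sum_eq_single j₀ (fun j _ hj => by simp [hj]) (by simp),
      column_tilt_self]
    simp
  have h2 : inner ℝ b (applyMat (tilt B j₀ b γ) (EuclideanSpace.single j₀ 1) - applyMat B a)
      = γ := by
    rw [h1, applyMat_eq_sum, inner_sub_right, inner_add_right, inner_sum]
    simp [real_inner_smul_right, hbB, hb]
  have h3 := abs_real_inner_le_norm b
    (applyMat (tilt B j₀ b γ) (EuclideanSpace.single j₀ 1) - applyMat B a)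
  rw [h2, hb, one_mul] at h3
  rw [← sq_abs γ]
  exact pow_le_pow_left₀ (abs_nonneg _) h3 2

end Tilt

/-! ### The risk as an estimation error -/

section Risk

variable {d k n : ℕ}

theorem memLp_inner_stdGaussian (x : EuclideanSpace ℝ (Fin d)) :
    MemLp (fun y => inner ℝ y x) 2 (stdGaussian (EuclideanSpace ℝ (Fin d))) := by
  have := (IsGaussian.memLp_two_id (μ := stdGaussian (EuclideanSpace ℝ (Fin d)))).inner_const
    (𝕜 := ℝ) x
  simpa using this

theorem integral_inner_mul_inner_stdGaussian (x y : EuclideanSpace ℝ (Fin d)) :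
    ∫ z, inner ℝ z x * inner ℝ z y ∂(stdGaussian (EuclideanSpace ℝ (Fin d))) = inner ℝ x y := by
  have h := covarianceBilin_apply
    (IsGaussian.memLp_two_id (μ := stdGaussian (EuclideanSpace ℝ (Fin d)))) x y
  rw [covarianceBilin_stdGaussian, innerSL_apply_apply] at h
  rw [h]
  simp [real_inner_comm]

theorem orthonormalFeatures_stdGaussian {B : Matrix (Fin d) (Fin k) ℝ} (hB : OrthonormalCols B) :
    OrthonormalFeatures (stdGaussian (EuclideanSpace ℝ (Fin d)))
      fun x j => inner ℝ x (column B j) where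
  measurable j := by fun_prop
  memLp j := memLp_inner_stdGaussian _
  integral_mul j l := by
    rw [integral_inner_mul_inner_stdGaussian]
    exact orthonormal_iff_ite.1 (orthonormalCols_iff.1 hB) j l

theorem taskLaw_eq_regressionLaw (B : Matrix (Fin d) (Fin k) ℝ) (a : EuclideanSpace ℝ (Fin k))
    (σ : ℝ) : taskLaw B a σ = regressionLaw (stdGaussian (EuclideanSpace ℝ (Fin d)))
      (fun x j => inner ℝ x (column B j)) (σ ^ 2).toNNReal a.ofLp := by
  simp only [taskLaw, regressionLaw, applyMat_eq_sum, inner_sum, real_inner_smul_right]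

instance isProbabilityMeasure_taskLaw (B : Matrix (Fin d) (Fin k) ℝ)
    (a : EuclideanSpace ℝ (Fin k)) (σ : ℝ) : IsProbabilityMeasure (taskLaw B a σ) := by
  rw [taskLaw_eq_regressionLaw]
  exact isProbabilityMeasure_regressionLaw (fun j => by fun_prop) _

instance isProbabilityMeasure_dataLaw (B : Matrix (Fin d) (Fin k) ℝ)
    (a : EuclideanSpace ℝ (Fin k)) (σ : ℝ) : IsProbabilityMeasure (dataLaw n B a σ) := by
  unfold dataLaw
  infer_instance

/-- The prediction error is `⟨x, Bα - w⟩ + η`; independence removes the cross term, and the identity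
covariance of `x` turns the first square into a squared norm. -/
theorem lintegral_sq_error (B : Matrix (Fin d) (Fin k) ℝ) (a : EuclideanSpace ℝ (Fin k)) (σ : ℝ)
    (w : EuclideanSpace ℝ (Fin d)) :
    ∫⁻ z, ENNReal.ofReal ((z.2 - inner ℝ w z.1) ^ 2) ∂(taskLaw B a σ)
      = ENNReal.ofReal (σ ^ 2 + ‖applyMat B a - w‖ ^ 2) := by
  set t := applyMat B a - w with ht
  set ν := stdGaussian (EuclideanSpace ℝ (Fin d)) with hν
  set N := gaussianReal 0 (σ ^ 2).toNNReal with hN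
  rw [taskLaw, lintegral_map (by fun_prop) (by fun_prop)]
  have e : ∀ p : EuclideanSpace ℝ (Fin d) × ℝ,
      (inner ℝ p.1 (applyMat B a) + p.2 - inner ℝ w p.1) ^ 2
        = inner ℝ p.1 t * inner ℝ p.1 t + 2 * (inner ℝ p.1 t * p.2) + p.2 ^ 2 := fun p => by
    rw [real_inner_comm p.1 w, ht, inner_sub_right]
    ring
  have i1 : Integrable (fun p : EuclideanSpace ℝ (Fin d) × ℝ => inner ℝ p.1 t * inner ℝ p.1 t)
      (ν.prod N) :=
    ((memLp_inner_stdGaussian t).integrable_mul (memLp_inner_stdGaussian t)).comp_fst N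
  have i2 : Integrable (fun p : EuclideanSpace ℝ (Fin d) × ℝ => 2 * (inner ℝ p.1 t * p.2))
      (ν.prod N) :=
    (((memLp_inner_stdGaussian t).integrable one_le_two).mul_prod
      ((memLp_id_gaussianReal (μ := 0) (v := (σ ^ 2).toNNReal) 2).integrable
        (by norm_num))).const_mul 2
  have i3 : Integrable (fun p : EuclideanSpace ℝ (Fin d) × ℝ => p.2 ^ 2) (ν.prod N) :=
    integrable_sq_gaussianReal.comp_snd ν
  have i12 : Integrable (fun p : EuclideanSpace ℝ (Fin d) × ℝ =>
      inner ℝ p.1 t * inner ℝ p.1 t + 2 * (inner ℝ p.1 t * p.2)) (ν.prod N) := i1.add i2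
  rw [← ofReal_integral_eq_lintegral_ofReal]
  · congr 1
    simp_rw [e]
    rw [integral_add i12 i3, integral_add i1 i2, integral_const_mul,
      integral_prod_mul (fun x => inner ℝ x t) (fun y : ℝ => y), integral_id_gaussianReal,
      integral_fun_fst (fun x => inner ℝ x t * inner ℝ x t), integral_fun_snd (fun y : ℝ => y ^ 2),
      integral_inner_mul_inner_stdGaussian, integral_sq_gaussianReal, real_inner_self_eq_norm_sq]
    simp [sq_nonneg, add_comm]
  · simp_rw [e]
    exact i12.add i3
  · exact Filter.Eventually.of_forall fun p => sq_nonneg _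

theorem risk_eq (M : Kernel (Dataset n d) (EuclideanSpace ℝ (Fin d)))
    (B : Matrix (Fin d) (Fin k) ℝ) (a : EuclideanSpace ℝ (Fin k)) (σ : ℝ) :
    risk M B a σ
      = ∫⁻ S, ∫⁻ w, ENNReal.ofReal (σ ^ 2 + ‖applyMat B a - w‖ ^ 2) ∂(M S) ∂(dataLaw n B a σ) := by
  simp only [risk, lintegral_sq_error]

/-- The bound holds for every admissible output separately, so the data and their law play no role.
-/
theorem exists_risk_ge_of_tilt {Bhat : Matrix (Fin d) (Fin k) ℝ} (hk : 1 ≤ k) (hkd : k < d)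
    (hB : OrthonormalCols Bhat) {M : Kernel (Dataset n d) (EuclideanSpace ℝ (Fin d))}
    [IsMarkovKernel M] (hM : OutputsInColSpan M Bhat) (σ : ℝ) {γ : ℝ} (hγ0 : 0 ≤ γ) (hγ : γ ≤ 1) :
    ∃ (B : Matrix (Fin d) (Fin k) ℝ) (a : EuclideanSpace ℝ (Fin k)), OrthonormalCols B ∧
      sinTheta B Bhat ≤ γ ∧ ‖applyMat B a‖ ≤ 1 ∧
      ENNReal.ofReal (σ ^ 2 + γ ^ 2) ≤ risk M B a σ := by
  obtain ⟨b, hb, hBb⟩ := exists_unit_orthogonal hkd Bhat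
  have hT := orthonormalCols_tilt hB hb hBb hγ0 hγ ⟨0, hk⟩
  refine ⟨tilt Bhat ⟨0, hk⟩ b γ, EuclideanSpace.single ⟨0, hk⟩ 1, hT,
    sinTheta_tilt_le hB hb hBb hγ0 hγ _, ?_, ?_⟩
  · refine abs_le_of_sq_le_sq' ?_ zero_le_one |>.2
    rw [norm_applyMat_sq hT, Finset.sum_eq_single ⟨0, hk⟩ (fun j _ hj => by simp [hj]) (by simp)]
    simp
  · rw [risk_eq]
    calc ENNReal.ofReal (σ ^ 2 + γ ^ 2)
        = ∫⁻ _S, ∫⁻ _w, ENNReal.ofReal (σ ^ 2 + γ ^ 2) ∂(M _S)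
          ∂(dataLaw n (tilt Bhat ⟨0, hk⟩ b γ) (EuclideanSpace.single ⟨0, hk⟩ 1) σ) := by simp
      _ ≤ _ := lintegral_mono fun S => lintegral_mono_ae <| by
        filter_upwards [hM S] with w hw
        obtain ⟨u, rfl⟩ := hw
        exact ENNReal.ofReal_le_ofReal (add_le_add_right (sq_le_norm_tilt_sub_sq hb hBb _ u) _)

end Risk

/-! ### From regression bounds to the risk -/

section LowerBound

variable {d k n : ℕ}

theorem sq_clip_sub_le {τ β x : ℝ} (hβ : |β| ≤ τ) :
    (max (-τ) (min τ x) - β) ^ 2 ≤ (x - β) ^ 2 := by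
  obtain ⟨h1, h2⟩ := abs_le.1 hβ
  rcases le_total τ x with h | h
  · rw [min_eq_left h, max_eq_right (by linarith)]
    exact pow_le_pow_left₀ (by linarith) (by linarith) 2
  · rw [min_eq_right h]
    rcases le_total (-τ) x with h' | h'
    · rw [max_eq_right h']
    · rw [max_eq_left h']
      nlinarith

/-- If the rate `R` violates one of the two lower bounds of private regression, then some task on
the known subspace has excess risk at least `R`. -/
theorem exists_risk_ge_of_private {Bhat : Matrix (Fin d) (Fin k) ℝ} (hB : OrthonormalCols Bhat)
    {M : Kernel (Dataset n d) (EuclideanSpace ℝ (Fin d))} [IsMarkovKernel M] {ε δ : ℝ}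
    (hM : IsDP M ε δ) (hε : 0 < ε) (hε1 : ε < 1) (hδ : 0 ≤ δ) (hn : 1 ≤ n)
    (hnδ : 24 * (n * δ) ≤ 1) (hk : 1 ≤ k) {σ τ : ℝ} (hσ : 0 < σ) (hτ : 0 < τ) (hτσ : τ ≤ σ)
    (hτk : k * τ ^ 2 ≤ 1) {R : ℝ} (hR0 : 0 ≤ R) (hRτ : 36 * R ≤ k * τ ^ 2)
    (hR : ¬(σ ^ 2 * k ^ 2 ≤ 144 * (n ^ 2 * ε ^ 2) * R ∧ σ ^ 2 * k ≤ 9 * n * R)) :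
    ∃ a : EuclideanSpace ℝ (Fin k), ‖applyMat Bhat a‖ ≤ 1 ∧
      ENNReal.ofReal (σ ^ 2 + R) ≤ risk M Bhat a σ := by
  by_contra! hlt
  -- Taking coordinates along the columns and clipping to `[-τ, τ]` is post-processing that does not
  -- increase the error, by Bessel's inequality and `sq_clip_sub_le`; it provides the boundedness
  -- needed above.
  set u : EuclideanSpace ℝ (Fin d) → Fin k → ℝ :=
    fun w j => max (-τ) (min τ (inner ℝ (column Bhat j) w)) with hu
  have hum : ∀ j, Measurable fun w => u w j := fun j => by fun_prop
  have huτ : ∀ w j, |u w j| ≤ τ := fun w j =>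
    abs_le.2 ⟨le_max_left _ _, max_le (by linarith) (min_le_left _ _)⟩
  refine hR ((orthonormalFeatures_stdGaussian hB).private_regression_lower_bound hε hε1 hδ hn hnδ hM
    hk hσ (Real.coe_toNNReal _ (sq_nonneg σ)) hτ hτσ hum huτ hR0 hRτ fun β hβ => ?_)
  set a : EuclideanSpace ℝ (Fin k) := WithLp.toLp 2 β with ha
  have hnorm : ‖applyMat Bhat a‖ ≤ 1 := by
    refine abs_le_of_sq_le_sq' ?_ zero_le_one |>.2
    rw [norm_applyMat_sq hB, one_pow]
    calc ∑ j, β j ^ 2 ≤ ∑ _j : Fin k, τ ^ 2 :=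
          Finset.sum_le_sum fun j _ => by linarith [weight_nonneg hβ j]
      _ = k * τ ^ 2 := by simp
      _ ≤ 1 := hτk
  have hdata : (Measure.pi fun _ : Fin n => regressionLaw (stdGaussian (EuclideanSpace ℝ (Fin d)))
      (fun x j => inner ℝ x (column Bhat j)) (σ ^ 2).toNNReal β) = dataLaw n Bhat a σ := by
    simp only [dataLaw, taskLaw_eq_regressionLaw, ha]
  rw [hdata]
  have hle : ∀ w, ∑ j, (u w j - β j) ^ 2 ≤ ‖applyMat Bhat a - w‖ ^ 2 := by
    intro w
    calc ∑ j, (u w j - β j) ^ 2 ≤ ∑ j, (inner ℝ (column Bhat j) w - β j) ^ 2 :=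
          Finset.sum_le_sum fun j _ => sq_clip_sub_le (hβ j)
      _ = ∑ j, ‖inner ℝ (column Bhat j) (applyMat Bhat a - w)‖ ^ 2 :=
          Finset.sum_congr rfl fun j _ => by
            rw [inner_sub_right, inner_applyMat hB, Real.norm_eq_abs, sq_abs]
            ring
      _ ≤ _ := (orthonormalCols_iff.1 hB).sum_inner_products_le _
  have hm : Measurable fun w => ∑ j, (u w j - β j) ^ 2 :=
    Finset.measurable_sum _ fun j _ => ((hum j).sub_const _).pow_const 2
  have h0 : ∀ w, 0 ≤ ∑ j, (u w j - β j) ^ 2 := fun w => Finset.sum_nonneg fun j _ => sq_nonneg _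
  have hi : Integrable (fun p : Dataset n d × EuclideanSpace ℝ (Fin d) =>
      ∑ j, (u p.2 j - β j) ^ 2) (dataLaw n Bhat a σ ⊗ₘ M) := by
    refine Integrable.of_bound (hm.comp measurable_snd).aestronglyMeasurable
      (∑ _j : Fin k, (2 * τ) ^ 2) (Filter.Eventually.of_forall fun p => ?_)
    rw [Real.norm_of_nonneg (h0 _)]
    refine Finset.sum_le_sum fun j _ => ?_
    rw [← sq_abs]
    exact pow_le_pow_left₀ (abs_nonneg _) ((abs_sub _ _).trans (by linarith [huτ p.2 j, hβ j])) 2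
  have hi' : Integrable (fun p : Dataset n d × EuclideanSpace ℝ (Fin d) =>
      σ ^ 2 + ∑ j, (u p.2 j - β j) ^ 2) (dataLaw n Bhat a σ ⊗ₘ M) := (integrable_const _).add hi
  have hmm : Measurable fun p : Dataset n d × EuclideanSpace ℝ (Fin d) =>
      ENNReal.ofReal (σ ^ 2 + ∑ j, (u p.2 j - β j) ^ 2) :=
    ((hm.comp measurable_snd).const_add _).ennreal_ofReal
  have h1 : ENNReal.ofReal (∫ p, (σ ^ 2 + ∑ j, (u p.2 j - β j) ^ 2) ∂(dataLaw n Bhat a σ ⊗ₘ M))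
      ≤ ENNReal.ofReal (σ ^ 2 + R) := by
    refine le_trans ?_ (hlt a hnorm).le
    rw [ofReal_integral_eq_lintegral_ofReal hi'
        (Filter.Eventually.of_forall fun p => add_nonneg (sq_nonneg σ) (h0 _)),
      Measure.lintegral_compProd hmm, risk_eq]
    exact lintegral_mono fun S => lintegral_mono fun w =>
      ENNReal.ofReal_le_ofReal (add_le_add_right (hle w) _)
  have h2 := (ENNReal.ofReal_le_ofReal_iff (by positivity)).1 h1
  rw [integral_add (integrable_const _) hi] at h2
  simpa using h2

theorem privateRate_pos {ε : ℝ} (hε : 0 < ε) (hn : 1 ≤ n) (hk : 1 ≤ k) :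
    0 < privateRate k n ε := by
  have : (0 : ℝ) < k := by exact_mod_cast hk
  have : (0 : ℝ) < n := by exact_mod_cast hn
  unfold privateRate
  positivity

/-- The condition on `k` bounds `k / (n ε)` by `C`, and `k / n` too since `ε < 1`. -/
theorem privateRate_le {C ε : ℝ} (hε : 0 < ε) (hε1 : ε < 1) (hn : 1 ≤ n)
    (hC : 0 < C) (hkC : (k : ℝ) ≤ C * (n * ε)) : privateRate k n ε ≤ C ^ 2 + C := by
  have hn0 : (0 : ℝ) < n := by exact_mod_cast hn
  refine add_le_add ?_ ?_
  · rw [div_le_iff₀ (by positivity)]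
    calc (k : ℝ) ^ 2 ≤ (C * (n * ε)) ^ 2 := pow_le_pow_left₀ (by positivity) hkC 2
      _ = _ := by ring
  · rw [div_le_iff₀ hn0]
    have : C * n * ε ≤ C * n * 1 := mul_le_mul_of_nonneg_left hε1.le (by positivity)
    linarith

theorem exists_risk_ge_privateRate {C : ℝ} (hC : 0 < C) {Bhat : Matrix (Fin d) (Fin k) ℝ}
    (hB : OrthonormalCols Bhat)
    {M : Kernel (Dataset n d) (EuclideanSpace ℝ (Fin d))} [IsMarkovKernel M] {ε δ : ℝ}
    (hM : IsDP M ε δ) (hε : 0 < ε) (hε1 : ε < 1) (hδ : 0 ≤ δ) (hn : 1 ≤ n)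
    (hnδ : 24 * (n * δ) ≤ 1) (hk : 1 ≤ k) (hkC : (k : ℝ) ≤ C * (n * ε)) {σ : ℝ} (hσ : 0 < σ) :
    ∃ a : EuclideanSpace ℝ (Fin k), ‖applyMat Bhat a‖ ≤ 1 ∧
      ENNReal.ofReal (σ ^ 2 + 1 / (300 * (1 + C + C ^ 2)) * min 1 (privateRate k n ε * σ ^ 2))
        ≤ risk M Bhat a σ := by
  have hr := privateRate_pos hε hn hk
  have hrC := privateRate_le hε hε1 hn hC hkC
  set r := privateRate k n ε with hrdef
  set m := min 1 (r * σ ^ 2) with hm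
  have hk1 : (1 : ℝ) ≤ k := by exact_mod_cast hk
  have hn0 : (0 : ℝ) < n := by exact_mod_cast hn
  have hK : 1 ≤ 1 + C + C ^ 2 := by nlinarith
  set K := 1 + C + C ^ 2 with hKdef
  have hm0 : 0 ≤ m := le_min zero_le_one (by positivity)
  have hm1 : m ≤ 1 := min_le_left _ _
  have hm2 : m ≤ r * σ ^ 2 := min_le_right _ _
  have hRm : 1 / (300 * K) * m ≤ 1 / 300 * m := by
    refine mul_le_mul_of_nonneg_right ?_ hm0
    exact one_div_le_one_div_of_le (by norm_num) (by linarith)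
  have hR0 : 0 ≤ 1 / (300 * K) * m := by positivity
  -- The side is `τ = min σ (1/√k)`: the first entry gives `τ ≤ σ`, the second keeps the whole box
  -- in the unit ball.
  have hτsq : k * (min σ (1 / √k)) ^ 2 = min (k * σ ^ 2) 1 := by
    have hsk : 0 < √(k : ℝ) := Real.sqrt_pos.2 (by linarith)
    have hsq : √(k : ℝ) ^ 2 = k := Real.sq_sqrt (by linarith)
    have h1 : (k : ℝ) * (1 / √k) ^ 2 = 1 := by
      rw [div_pow, hsq]
      field_simp
    rcases le_total σ (1 / √k) with h | h
    · rw [min_eq_left h, min_eq_left]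
      rw [← h1]
      exact mul_le_mul_of_nonneg_left (pow_le_pow_left₀ hσ.le h 2) (by linarith)
    · rw [min_eq_right h, h1, min_eq_right]
      rw [← h1]
      exact mul_le_mul_of_nonneg_left (pow_le_pow_left₀ (by positivity) h 2) (by linarith)
  refine exists_risk_ge_of_private hB hM hε hε1 hδ hn hnδ hk hσ (τ := min σ (1 / √k))
    (lt_min hσ (by positivity)) (min_le_left _ _) ?_ hR0 ?_ ?_
  · rw [hτsq]
    exact min_le_right _ _
  · rw [hτsq]
    refine le_min ?_ (by linarith)
    have h1 : m ≤ K * (k * σ ^ 2) := by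
      calc m ≤ r * σ ^ 2 := hm2
        _ ≤ K * σ ^ 2 := mul_le_mul_of_nonneg_right (by linarith) (sq_nonneg σ)
        _ ≤ K * (k * σ ^ 2) := by
          refine mul_le_mul_of_nonneg_left ?_ (by linarith)
          nlinarith [sq_nonneg σ]
    calc 36 * (1 / (300 * K) * m) ≤ 36 * (1 / (300 * K) * (K * (k * σ ^ 2))) := by gcongr
      _ = 36 / 300 * (k * σ ^ 2) := by field_simp
      _ ≤ k * σ ^ 2 := by nlinarith [sq_nonneg σ]
  -- Adding the two bounds gives `r σ² ≤ (144 + 9)/300 * m` with `m ≤ r σ²`, a contradiction.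
  · rintro ⟨h1, h2⟩
    have h3 : σ ^ 2 * (k ^ 2 / (n ^ 2 * ε ^ 2)) ≤ 144 * (1 / (300 * K) * m) := by
      rw [← mul_div_assoc, div_le_iff₀ (by positivity)]
      linarith
    have h4 : σ ^ 2 * (k / n) ≤ 9 * (1 / (300 * K) * m) := by
      rw [← mul_div_assoc, div_le_iff₀ hn0]
      linarith
    have h5 : r * σ ^ 2 = σ ^ 2 * (k ^ 2 / (n ^ 2 * ε ^ 2)) + σ ^ 2 * (k / n) := by
      rw [hrdef, privateRate]
      ring
    have h6 : 0 < r * σ ^ 2 := by positivity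
    linarith

/-- The product is `n^(-ω)`, which tends to zero. This is the only place where the threshold on `n`
depends on `ω`. -/
theorem exists_forall_ge_mul_rpow_le {ω : ℝ} (hω : 0 < ω) :
    ∃ n₀ : ℕ, 1 ≤ n₀ ∧ ∀ n : ℕ, n₀ ≤ n → 24 * (n * (n : ℝ) ^ (-(1 + ω))) ≤ 1 := by
  have h := ((tendsto_rpow_neg_atTop hω).comp tendsto_natCast_atTop_atTop).eventually
    (gt_mem_nhds (by norm_num : (0 : ℝ) < 1 / 24))
  obtain ⟨N, hN⟩ := Filter.eventually_atTop.1 h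
  refine ⟨N + 1, by omega, fun n hn => ?_⟩
  have h1 := hN n (by omega)
  have hn0 : (0 : ℝ) < n := by exact_mod_cast (by omega : 0 < n)
  have e : n * (n : ℝ) ^ (-(1 + ω)) = (n : ℝ) ^ (-ω) := by
    rw [show -(1 + ω) = -ω - 1 by ring, Real.rpow_sub_one hn0.ne']
    field_simp
  rw [e]
  simp only [Function.comp] at h1
  linarith

end LowerBound

end PrivateTransfer

end

/-! ### Combination of the two instances -/

theorem theorem5p4 :
    ∀ C : ℝ, 0 < C → ∃ c : ℝ, 0 < c ∧ ∀ ω : ℝ, 0 < ω → ∃ n₀ : ℕ,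
      ∀ (d k n : ℕ), 1 ≤ k → k < d → n₀ ≤ n →
      ∀ (ε δ σ γ : ℝ), 0 < ε → ε < 1 → 0 ≤ δ → δ < (n : ℝ) ^ (-(1 + ω)) →
        0 < σ → 0 ≤ γ → γ ≤ 1 → (k : ℝ) ≤ C * (n * ε) →
      ∀ Bhat : Matrix (Fin d) (Fin k) ℝ, PrivateTransfer.OrthonormalCols Bhat →
      ∀ M : Kernel (PrivateTransfer.Dataset n d) (EuclideanSpace ℝ (Fin d)), IsMarkovKernel M →
        PrivateTransfer.IsDP M ε δ → PrivateTransfer.OutputsInColSpan M Bhat →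
      ∃ (B : Matrix (Fin d) (Fin k) ℝ) (a : EuclideanSpace ℝ (Fin k)),
        PrivateTransfer.OrthonormalCols B ∧
        PrivateTransfer.sinTheta B Bhat ≤ γ ∧
        ‖PrivateTransfer.applyMat B a‖ ≤ 1 ∧
        ENNReal.ofReal
            (c * (PrivateTransfer.privateRate k n ε * (σ ^ 2 + γ ^ 2) + γ ^ 2))
          ≤ PrivateTransfer.risk M B a σ ∧
        ENNReal.ofReal
            (σ ^ 2 + c * (min 1 (PrivateTransfer.privateRate k n ε * (σ ^ 2 + γ ^ 2)) + γ ^ 2))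
          ≤ PrivateTransfer.risk M B a σ := by
  intro C hC
  have hK : 1 ≤ 1 + C + C ^ 2 := by nlinarith
  set K := 1 + C + C ^ 2 with hKdef
  refine ⟨1 / (600 * K ^ 2), by positivity, fun ω hω => ?_⟩
  obtain ⟨n₀, hn₀, hN⟩ := PrivateTransfer.exists_forall_ge_mul_rpow_le hω
  refine ⟨n₀, fun d k n hk hkd hn ε δ σ γ hε hε1 hδ hδ1 hσ hγ0 hγ1 hkC Bhat hB M hMark hM hspan => ?_⟩
  have hn1 : 1 ≤ n := hn₀.trans hn
  have hnδ : 24 * (n * δ) ≤ 1 := by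
    have := mul_le_mul_of_nonneg_left hδ1.le (Nat.cast_nonneg (α := ℝ) n)
    linarith [hN n hn]
  have hr := PrivateTransfer.privateRate_pos hε hn1 hk
  have hrC := PrivateTransfer.privateRate_le hε hε1 hn1 hC hkC
  have hpriv := PrivateTransfer.exists_risk_ge_privateRate hC hB hM hε hε1 hδ hn1 hnδ hk hkC hσ
  rw [← hKdef] at hpriv
  set r := PrivateTransfer.privateRate k n ε with hrdef
  set m := min 1 (r * σ ^ 2) with hm
  have hm0 : 0 ≤ m := le_min zero_le_one (by positivity)
  have hσ2 : 0 < σ ^ 2 := by positivity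
  have hγ2 : 0 ≤ γ ^ 2 := sq_nonneg γ
  have hc1 : 1 / (600 * K ^ 2) * K ≤ 1 / 600 := by
    rw [div_mul_eq_mul_div, div_le_div_iff₀ (by positivity) (by norm_num)]
    nlinarith
  -- The `γ²` part of the rate term is at most `(C² + C) γ²`, so only `m`, which involves `σ` alone,
  -- has to come from private regression.
  have hmin : min 1 (r * (σ ^ 2 + γ ^ 2)) + γ ^ 2 ≤ m + K * γ ^ 2 := by
    have h1 : min 1 (r * (σ ^ 2 + γ ^ 2)) ≤ m + r * γ ^ 2 := by
      have h0 : 0 ≤ r * γ ^ 2 := by positivity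
      rw [hm, ← min_add_add_right]
      exact min_le_min (by linarith) (by linarith)
    have h2 : r * γ ^ 2 ≤ (C ^ 2 + C) * γ ^ 2 := mul_le_mul_of_nonneg_right hrC hγ2
    rw [hKdef]
    linarith
  have hbound1 : 1 / (600 * K ^ 2) * (r * (σ ^ 2 + γ ^ 2) + γ ^ 2) ≤ σ ^ 2 + γ ^ 2 := by
    have h1 : r * (σ ^ 2 + γ ^ 2) + γ ^ 2 ≤ K * (σ ^ 2 + γ ^ 2) := by
      have := mul_le_mul_of_nonneg_right hrC (by positivity : 0 ≤ σ ^ 2 + γ ^ 2)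
      rw [hKdef]
      linarith
    have h2 := mul_le_mul_of_nonneg_left h1 (by positivity : 0 ≤ 1 / (600 * K ^ 2))
    have h3 := mul_le_mul_of_nonneg_right hc1 (by positivity : 0 ≤ σ ^ 2 + γ ^ 2)
    linarith
  have hbound2 : 1 / (600 * K ^ 2) * (min 1 (r * (σ ^ 2 + γ ^ 2)) + γ ^ 2)
      ≤ 1 / (300 * K) * m / 2 + γ ^ 2 / 600 := by
    have h1 := mul_le_mul_of_nonneg_left hmin (by positivity : 0 ≤ 1 / (600 * K ^ 2))
    have h2 := mul_le_mul_of_nonneg_right hc1 hγ2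
    have h3 : 1 / (600 * K ^ 2) * m ≤ 1 / (300 * K) * m / 2 := by
      have : 1 / (600 * K ^ 2) ≤ 1 / (600 * K) :=
        one_div_le_one_div_of_le (by positivity) (by nlinarith)
      calc _ ≤ 1 / (600 * K) * m := mul_le_mul_of_nonneg_right this hm0
        _ = _ := by
          field_simp
          ring
    linarith
  -- The instance with the larger guaranteed excess is taken; the factor `K²` in `c` leaves room for
  -- it to dominate both terms.
  rcases le_total (γ ^ 2) (1 / (300 * K) * m) with hle | hle
  · obtain ⟨a, ha, hrisk⟩ := hpriv
    refine ⟨Bhat, a, hB, ?_, ha, le_trans (ENNReal.ofReal_le_ofReal ?_) hrisk,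
      le_trans (ENNReal.ofReal_le_ofReal ?_) hrisk⟩
    · rw [PrivateTransfer.sinTheta, sub_self, map_zero, norm_zero]
      exact hγ0
    · linarith
    · linarith
  · obtain ⟨B, a, hB', hs, ha, hrisk⟩ :=
      PrivateTransfer.exists_risk_ge_of_tilt hk hkd hB hspan σ hγ0 hγ1
    refine ⟨B, a, hB', hs, ha, le_trans (ENNReal.ofReal_le_ofReal hbound1) hrisk,
      le_trans (ENNReal.ofReal_le_ofReal ?_) hrisk⟩
    linarith
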